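/- Let $\varepsilon>0$ and let $H(K)$ be the reproducing kernel Hilbert space of real-valued functions on $[-1,1]$ with kernel $K(x,y)=e^{\varepsilon xy}$, $x,y\in[-1,1]$. For $n\in\mathbb N$ consider linear approximations $$A_nf=\sum_{k=1}^n f(x_k)\psi_k ,\qquad f\in H(K),\tag{1}$$ with pairwise distinct points $x_1,\dots,x_n\in[-1,1]$ and real-valued Lebesgue measurable functions $\psi_1,\dots,\psi_n$ on $[-1,1]$. Put $$e_\infty(A_n)=\sup_{0\neq f\in H(K)}\frac{\sup_{x\in[-1,1]}|f(x)-(A_nf)(x)|}{\|f\|_{H(K)}}\in[0,\infty],\qquad e_\infty^{\min}(n)=\inf_{A_n}e_\infty(A_n),$$ the infimum being over all approximations of the form (1) (over all points and all functions $\psi_k$). For $t>0$ let $$c_L(t)=\frac{e^{-\frac32t+2\sqrt t}}{2\sqrt\pi\,t^{1/4}}\Big(3+\sqrt{\tfrac{\pi}{e}}+\frac{2}{\sqrt\pi\,t^{1/4}}+\frac{7}{16\sqrt t}+\sqrt t\,(2+t)\Big),\qquad m_L(t)=\max\Big\{5t,\;t\big(1+\tfrac t2\big)^2,\;\tfrac9t\Big\},$$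 and let $$c_1=\sqrt{\frac{2}{1+\varepsilon}}\;e^{-\frac1{32}\varepsilon^2},\qquad c_2=2\sqrt{c_L(\varepsilon)} .$$ Then for every $n\ge m_L(\varepsilon)$ $$c_1\Big(\frac{\varepsilon^{1/2}}2\Big)^n(n!)^{-1/2}\;\le\;e_\infty^{\min}(n)\;\le\;c_2\,n^{-1/8}e^{\sqrt{\varepsilon n}}\Big(\frac{\varepsilon^{1/2}}2\Big)^n(n!)^{-1/2},$$ and for any pairwise distinct points $x_1,\dots,x_n\in[-1,1]$ there is a linear approximation $A_n$ of the form (1), using these points, such that $$c_1\Big(\frac{\varepsilon^{1/2}}2\Big)^n(n!)^{-1/2}\;\le\;e_\infty(A_n)\;\le\;\frac{c_2}2\,n^{-1/8}e^{\sqrt{\varepsilon n}}\,(2\varepsilon^{1/2})^n(n!)^{-1/2}.$$ -/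

import Mathlib

open scoped ENNReal Nat

namespace ExpKernel

/-- The domain `[-1, 1]`. -/
abbrev Dom : Type := Set.Icc (-1 : ℝ) 1

/-- The (possibly infinite) supremum norm `sup_{x ∈ [-1, 1]} |g x|`. -/
noncomputable def supNorm (g : Dom → ℝ) : ℝ≥0∞ := ⨆ x : Dom, ‖g x‖ₑ

/-- The data of a linear approximation `A f = ∑ₖ f(xₖ) ψₖ`: pairwise distinct points
`xₖ ∈ [-1, 1]` and real-valued Lebesgue measurable functions `ψₖ` on `[-1, 1]`. -/
structure LinApprox (n : ℕ) where
  point : Fin n → Dom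
  point_injective : Function.Injective point
  weight : Fin n → Dom → ℝ
  /-- Measurability with respect to the Lebesgue σ-algebra of `[-1, 1]` (the completion of the
  Borel σ-algebra under the restriction of Lebesgue measure). -/
  weight_measurable : ∀ k, MeasureTheory.NullMeasurable (weight k)
    (MeasureTheory.Measure.comap (Subtype.val : Dom → ℝ) MeasureTheory.volume)

/-- The function `A f = ∑ₖ f(xₖ) ψₖ`. -/
noncomputable def LinApprox.apply {n : ℕ} (A : LinApprox n) (f : Dom → ℝ) : Dom → ℝ :=
  fun x => ∑ k : Fin n, f (A.point k) * A.weight k x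

/-- The worst-case error `sup_{0 ≠ f ∈ H} ‖f - A f‖_∞ / ‖f‖_H` over a reproducing kernel Hilbert
space `H` of functions on `[-1, 1]`. -/
noncomputable def LinApprox.errorOn {n : ℕ} (A : LinApprox n) (H : Type*)
    [NormedAddCommGroup H] [InnerProductSpace ℝ H] [RKHS ℝ H Dom ℝ] : ℝ≥0∞ :=
  ⨆ (f : H) (_ : f ≠ 0), supNorm (fun x => f x - A.apply f x) / ‖f‖ₑ

/-- A scalar kernel as a matrix of (multiplication) operators on `ℝ`. -/
noncomputable def kernelMatrix (K : Dom → Dom → ℝ) : Matrix Dom Dom (ℝ →L[ℝ] ℝ) :=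
  Matrix.of fun x y => K x y • ContinuousLinearMap.id ℝ ℝ

/-- The worst-case error `e_∞(A)` over the reproducing kernel Hilbert space `H(K)` of a
positive-semidefinite kernel `K`. -/
noncomputable def worstCaseError (K : Dom → Dom → ℝ) (hK : (kernelMatrix K).PosSemidef)
    {n : ℕ} (A : LinApprox n) : ℝ≥0∞ :=
  haveI : Fact (kernelMatrix K).PosSemidef := ⟨hK⟩
  A.errorOn (RKHS.OfKernel (kernelMatrix K))

/-- The `n`th minimal error `e_∞^min(n)` over `H(K)`. -/
noncomputable def minimalError (K : Dom → Dom → ℝ) (hK : (kernelMatrix K).PosSemidef)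
    (n : ℕ) : ℝ≥0∞ :=
  ⨅ A : LinApprox n, worstCaseError K hK A

/-- The exponential kernel `K(x, y) = exp(ε x y)` on `[-1, 1]`. -/
noncomputable def expKernel (ε : ℝ) (x y : Dom) : ℝ := Real.exp (ε * x * y)

theorem expKernel_posSemidef {ε : ℝ} (hε : 0 ≤ ε) :
    (kernelMatrix (expKernel ε)).PosSemidef := by
  have key := (RKHS.posSemidef_tfae (K := kernelMatrix (expKernel ε))).out 0 2
  refine key.2 ⟨?_, fun vv => ?_⟩
  · ext x y
    simp [kernelMatrix, expKernel, Matrix.conjTranspose_apply, mul_right_comm,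
      show star (ContinuousLinearMap.id ℝ ℝ) = ContinuousLinearMap.id ℝ ℝ from
        star_one (ℝ →L[ℝ] ℝ)]
  · have h : ∀ x y : Dom, HasSum (fun k : ℕ => ε ^ k / k ! * ((x : ℝ) ^ k * (y : ℝ) ^ k))
        (expKernel ε x y) := by
      intro x y
      have := NormedSpace.expSeries_div_hasSum_exp (ε * x * y : ℝ)
      rw [← Real.exp_eq_exp_ℝ] at this
      refine this.congr_fun ?_
      intro k
      simp only [mul_pow]
      ring
    have h2 : HasSum (fun k : ℕ => ε ^ k / k ! * (∑ x ∈ vv.support, (x : ℝ) ^ k * vv x) ^ 2)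
        (∑ x ∈ vv.support, ∑ y ∈ vv.support, expKernel ε y x * (vv x * vv y)) := by
      refine (hasSum_sum fun x _ => hasSum_sum fun y _ =>
        (h y x).mul_right (vv x * vv y)).congr_fun ?_
      intro k
      rw [sq, Finset.sum_mul_sum, Finset.mul_sum]
      refine Finset.sum_congr rfl fun x _ => ?_
      rw [Finset.mul_sum]
      refine Finset.sum_congr rfl fun y _ => ?_
      ring
    have h3 := h2.nonneg fun k => by positivity
    simp only [Finsupp.sum, RCLike.re_to_real]
    refine h3.trans_eq (Finset.sum_congr rfl fun x _ => Finset.sum_congr rfl fun y _ => ?_)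
    simp [kernelMatrix]
    ring

/-- The constant `c_L(t)`, for `t > 0`. -/
noncomputable def cL (t : ℝ) : ℝ :=
  Real.exp (-(3 / 2) * t + 2 * √t) / (2 * √Real.pi * t ^ (1 / 4 : ℝ)) *
    (3 + √(Real.pi / Real.exp 1) + 2 / (√Real.pi * t ^ (1 / 4 : ℝ)) + 7 / (16 * √t)
      + √t * (2 + t))

/-- The threshold `m_L(t)`, for `t > 0`. -/
noncomputable def mL (t : ℝ) : ℝ := max (max (5 * t) (t * (1 + t / 2) ^ 2)) (9 / t)

/-- The constant `c₁` in the lower bounds. -/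
noncomputable def c₁ (ε : ℝ) : ℝ := √(2 / (1 + ε)) * Real.exp (-(1 / 32) * ε ^ 2)

/-- The constant `c₂` in the upper bounds. -/
noncomputable def c₂ (ε : ℝ) : ℝ := 2 * √(cL ε)

end ExpKernel

/-! By duality, the worst-case error is governed by the norms, over `x`, of the representers of `f ↦
f x - A f x`, which are finite combinations of kernel functions. Since `εxy = -εc² + εcx + εcy +
ε(x-c)(y-c)`, the squared norm of such a combination is, for every centre `c`, a weighted `ℓ²` sum
of its exponentially tilted moments about `c` (`hasSum_norm_kerComb_expKernel`).

Upper bound: take Lagrange basis polynomials times `exp(εc(y - xₖ))` as weights. The exponentials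
cancel, and the `j`-th moment becomes the interpolation remainder of a shifted monomial: `∏(y - xₖ)`
times the complete homogeneous symmetric polynomial of degree `j - n` in the `n + 1` shifted points
(`pow_sub_lagrange_eq`). If `c` is the mean of nodes and evaluation point, the generating function
`∏ 1/(1 - yᵢX)` has no linear term, so these polynomials cost only a factor `exp(17ε/5)` in the
squared norm. For `n ≥ m_L(ε)` this is absorbed by `c_L(ε) n^(-1/4) exp(2√(εn))`. The nodes enter
only through the nodal polynomial, at most `2^(1-n)` for Chebyshev nodes and `2^n` always.

Lower bound: a nonzero polynomial `p` of degree at most `n` vanishes at the nodes, so `A p = 0` and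
the error is at least `max |p| / ‖p‖`. The maximum dominates the `L²` norm for the arcsine law;
Cauchy–Schwarz in the Chebyshev coefficients bounds `‖p‖` through the norms of `T₀, …, Tₙ`, of which
`Tₙ` gives the main term. -/

namespace ExpKernel

/-! ### Worst-case error as a norm of representers -/

section Duality

variable {K : Dom → Dom → ℝ} [Fact (kernelMatrix K).PosSemidef]

/-- The combination `∑ᵢ wᵢ K(·, zᵢ)` of kernel functions in `H(K)`. -/
noncomputable def kerComb (K : Dom → Dom → ℝ) [Fact (kernelMatrix K).PosSemidef] {ι : Type*}
    [Fintype ι] (z : ι → Dom) (w : ι → ℝ) : RKHS.OfKernel (kernelMatrix K) :=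
  ∑ i, w i • RKHS.kerFun (RKHS.OfKernel (kernelMatrix K)) (z i) (1 : ℝ)

lemma inner_kerComb {ι : Type*} [Fintype ι] (z : ι → Dom) (w : ι → ℝ)
    (f : RKHS.OfKernel (kernelMatrix K)) :
    inner ℝ f (kerComb K z w) = ∑ i, w i * f (z i) := by
  simp [kerComb, inner_sum, inner_smul_right]

lemma kerComb_apply {ι : Type*} [Fintype ι] (z : ι → Dom) (w : ι → ℝ) (y : Dom) :
    (kerComb K z w) y = ∑ i, w i * K y (z i) := by
  have h := RKHS.kerFun_inner (H := RKHS.OfKernel (kernelMatrix K)) y (1 : ℝ) (kerComb K z w)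
  rw [inner_kerComb] at h
  simp only [RCLike.inner_apply, conj_trivial, mul_one] at h
  rw [← h]
  refine Finset.sum_congr rfl fun i _ => ?_
  rw [RKHS.kerFun_apply, RKHS.OfKernel.kernel_ofKernel]
  have hs := (Fact.out : (kernelMatrix K).PosSemidef).isHermitian.apply (z i) y
  have := congrArg (fun T : ℝ →L[ℝ] ℝ => T 1) hs
  simp [kernelMatrix, show star (ContinuousLinearMap.id ℝ ℝ) = ContinuousLinearMap.id ℝ ℝ from
        star_one (ℝ →L[ℝ] ℝ)] at this ⊢
  left; linarith

lemma norm_kerComb_sq {ι : Type*} [Fintype ι] (z : ι → Dom) (w : ι → ℝ) :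
    ‖kerComb K z w‖ ^ 2 = ∑ i, ∑ j, w i * w j * K (z i) (z j) := by
  rw [← real_inner_self_eq_norm_sq, inner_kerComb]
  simp only [kerComb_apply, Finset.mul_sum, mul_assoc]

/-- The representer of the functional `f ↦ f x - (A f) x`. -/
noncomputable def LinApprox.errorRep {n : ℕ} (A : LinApprox n) (K : Dom → Dom → ℝ)
    [Fact (kernelMatrix K).PosSemidef] (x : Dom) : RKHS.OfKernel (kernelMatrix K) :=
  kerComb K (fun i : Option (Fin n) => i.elim x A.point)
    (fun i : Option (Fin n) => i.elim 1 fun k => - A.weight k x)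

lemma inner_errorRep {n : ℕ} (A : LinApprox n) (x : Dom)
    (f : RKHS.OfKernel (kernelMatrix K)) :
    inner ℝ f (A.errorRep K x) = f x - A.apply f x := by
  rw [LinApprox.errorRep, inner_kerComb]
  simp [Fintype.sum_option, LinApprox.apply, mul_comm, sub_eq_add_neg]

lemma errorOn_le {n : ℕ} (A : LinApprox n) {B : ℝ} (hB : ∀ x, ‖A.errorRep K x‖ ≤ B) :
    A.errorOn (RKHS.OfKernel (kernelMatrix K)) ≤ ENNReal.ofReal B := by
  have hB0 : 0 ≤ B := (norm_nonneg _).trans (hB ⟨0, by norm_num⟩)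
  refine iSup₂_le fun f hf => ?_
  refine ENNReal.div_le_of_le_mul (iSup_le fun x => ?_)
  simp only [← inner_errorRep]
  rw [← ofReal_norm, ← ofReal_norm, ← ENNReal.ofReal_mul hB0]
  refine ENNReal.ofReal_le_ofReal ((norm_inner_le_norm _ _).trans ?_)
  rw [mul_comm]
  gcongr
  exact hB x

/-- The representer is itself the extremal test function. -/
lemma norm_errorRep_le_errorOn {n : ℕ} (A : LinApprox n) (x : Dom) :
    ENNReal.ofReal ‖A.errorRep K x‖ ≤ A.errorOn (RKHS.OfKernel (kernelMatrix K)) := by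
  by_cases h0 : A.errorRep K x = 0
  · simp [h0]
  refine le_trans ?_ (le_iSup₂ (A.errorRep K x) h0)
  have hne : ‖A.errorRep K x‖ₑ ≠ 0 := by simpa using h0
  rw [ENNReal.le_div_iff_mul_le (Or.inl hne) (Or.inl (by simp)), ofReal_norm]
  refine le_trans (le_of_eq ?_) (le_iSup _ x)
  simp only [← inner_errorRep]
  rw [real_inner_self_eq_norm_sq, ← ofReal_norm, ← ofReal_norm,
    ← ENNReal.ofReal_mul (norm_nonneg _)]
  simp [sq]

end Duality

/-! ### Expansion of the exponential kernel about a centre -/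

section ExpKernelNorm

variable {ε : ℝ}

/-- The centre is free: the upper bound uses the mean of the points, the lower bound uses `c = 0`.
-/
lemma hasSum_norm_kerComb_expKernel [Fact (kernelMatrix (expKernel ε)).PosSemidef]
    {ι : Type*} [Fintype ι] (z : ι → Dom) (w : ι → ℝ) (c : ℝ) :
    HasSum (fun j : ℕ => Real.exp (-(ε * c ^ 2)) * (ε ^ j / j !) *
        (∑ i, w i * Real.exp (ε * c * z i) * ((z i : ℝ) - c) ^ j) ^ 2)
      (‖kerComb (expKernel ε) z w‖ ^ 2) := by
  have h : ∀ x y : Dom, HasSum (fun j : ℕ => Real.exp (-(ε * c ^ 2)) * (ε ^ j / j !) *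
      (Real.exp (ε * c * x) * Real.exp (ε * c * y) * (((x : ℝ) - c) ^ j * ((y : ℝ) - c) ^ j)))
      (expKernel ε x y) := by
    intro x y
    have := (NormedSpace.expSeries_div_hasSum_exp (ε * (x - c) * (y - c) : ℝ)).mul_left
      (Real.exp (-(ε * c ^ 2)) * (Real.exp (ε * c * x) * Real.exp (ε * c * y)))
    rw [← Real.exp_eq_exp_ℝ, ← Real.exp_add, ← Real.exp_add, ← Real.exp_add] at this
    have he : expKernel ε x y = Real.exp (-(ε * c ^ 2) + (ε * c * x + ε * c * y) +
        ε * (x - c) * (y - c)) := by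
      rw [expKernel]; congr 1; ring
    rw [he]
    refine this.congr_fun fun j => ?_
    rw [Real.exp_add, Real.exp_add, mul_pow, mul_pow]
    ring
  rw [norm_kerComb_sq]
  refine (hasSum_sum fun i _ => hasSum_sum fun j _ =>
    (h (z i) (z j)).mul_left (w i * w j)).congr_fun ?_
  intro m
  rw [sq (∑ i, _), Finset.sum_mul_sum, Finset.mul_sum]
  refine Finset.sum_congr rfl fun x _ => ?_
  rw [Finset.mul_sum]
  refine Finset.sum_congr rfl fun y _ => ?_
  ring

end ExpKernelNorm

/-! ### Interpolation remainders of monomials via generating functions -/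

section Geometric

open PowerSeries

/-- The geometric power series `∑ aᵐ Xᵐ = 1 / (1 - a X)`. -/
noncomputable def geomSeries (a : ℝ) : ℝ⟦X⟧ := mk fun m => a ^ m

lemma coeff_geomSeries (a : ℝ) (m : ℕ) : coeff m (geomSeries a) = a ^ m := coeff_mk _ _

lemma geomSeries_eq_rescale (a : ℝ) : geomSeries a = rescale a (mk 1) := by
  ext m; simp [geomSeries]

lemma geomSeries_mul (a : ℝ) : geomSeries a * (1 - C a * X) = 1 := by
  have h := congrArg (rescale a) (mk_one_mul_one_sub_eq_one ℝ)
  simpa [geomSeries_eq_rescale, rescale_X] using h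

/-- The remainder of Lagrange interpolation of the monomial `y ^ j`. -/
lemma pow_sub_lagrange_eq {n : ℕ} {y : Fin n → ℝ} (hy : Function.Injective y) (Y : ℝ) (j : ℕ) :
    Y ^ j - ∑ k, (Lagrange.basis Finset.univ y k).eval Y * y k ^ j =
      (∏ k, (Y - y k)) * coeff j (X ^ n * (geomSeries Y * ∏ k, geomSeries (y k))) := by
  classical
  set l : Fin n → ℝ := fun k => (Lagrange.basis Finset.univ y k).eval Y with hl
  have hinterp : ∀ p : Polynomial ℝ, p.degree < n → p.eval Y = ∑ k, l k * p.eval (y k) := by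
    intro p hp
    have h := Lagrange.eq_interpolate (s := Finset.univ) (v := y) hy.injOn (f := p)
      (by simpa using hp)
    conv_lhs => rw [h]
    simp [Lagrange.interpolate_apply, Polynomial.eval_finsetSum, hl, mul_comm]
  -- Generating function in `j` of all the remainders. Its coefficients below `n` vanish by
  -- exactness of interpolation.
  set Q : ℝ⟦X⟧ := geomSeries Y - ∑ k, C (l k) * geomSeries (y k) with hQ
  have hQc : ∀ j, coeff j Q = Y ^ j - ∑ k, l k * y k ^ j := by
    intro j; simp [hQ, coeff_geomSeries]
  have hQlt : ∀ j < n, coeff j Q = 0 := by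
    intro j hj
    have := hinterp (Polynomial.X ^ j) (by rw [Polynomial.degree_X_pow]; exact_mod_cast hj)
    simp only [Polynomial.eval_pow, Polynomial.eval_X] at this
    rw [hQc, this, sub_self]
  have hQn : coeff n Q = ∏ k, (Y - y k) := by
    have hd : (Polynomial.X ^ n - Lagrange.nodal Finset.univ y).degree < (n : WithBot ℕ) := by
      have := Polynomial.degree_sub_lt_left (p := Polynomial.X ^ n)
        (q := Lagrange.nodal Finset.univ y) (by simp [Lagrange.degree_nodal])
        (by simp) (by simp [Lagrange.nodal_monic.leadingCoeff])
      simpa using this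
    have := hinterp _ hd
    simp only [Polynomial.eval_sub, Polynomial.eval_pow, Polynomial.eval_X,
      Lagrange.eval_nodal_at_node (Finset.mem_univ _), sub_zero, Lagrange.eval_nodal] at this
    rw [hQc, ← this]; ring
  -- Clearing the denominator `D` of `Q` leaves a polynomial of degree at most `n`. As `Q` starts at
  -- order `n`, this polynomial is a multiple of `Xⁿ`.
  set P : Polynomial ℝ := ∏ k, (1 - Polynomial.C (y k) * Polynomial.X) -
    (1 - Polynomial.C Y * Polynomial.X) * ∑ k, Polynomial.C (l k) *
      ∏ i ∈ Finset.univ.erase k, (1 - Polynomial.C (y i) * Polynomial.X) with hP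
  set D : ℝ⟦X⟧ := (1 - C Y * X) * ∏ k, (1 - C (y k) * X) with hD
  have hlin : ∀ a : ℝ, (1 - Polynomial.C a * Polynomial.X : Polynomial ℝ).natDegree ≤ 1 := by
    intro a; compute_degree
  have hPdeg : P.natDegree ≤ n := by
    refine (Polynomial.natDegree_sub_le_of_le (m := n) (n := n) ?_ ?_).trans (by simp)
    · refine (Polynomial.natDegree_prod_le _ _).trans
        ((Finset.sum_le_sum fun i _ => hlin _).trans (by simp))
    -- For `n = 0` the sum is empty, and the count `1 + (n - 1)` below would be off by one.
    · rcases Nat.eq_zero_or_pos n with rfl | hn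
      · simp
      refine Polynomial.natDegree_mul_le.trans ?_
      have : (∑ k, Polynomial.C (l k) * ∏ i ∈ Finset.univ.erase k,
          (1 - Polynomial.C (y i) * Polynomial.X)).natDegree ≤ n - 1 := by
        refine Polynomial.natDegree_sum_le_of_forall_le _ _ fun k _ => ?_
        refine (Polynomial.natDegree_C_mul_le _ _).trans
          ((Polynomial.natDegree_prod_le _ _).trans
          ((Finset.sum_le_sum fun i _ => hlin _).trans ?_))
        simp
      have := hlin Y
      omega
  have hQD : Q * D = (P : ℝ⟦X⟧) := by
    have hcoe : ∀ a : ℝ, ((1 - Polynomial.C a * Polynomial.X : Polynomial ℝ) : ℝ⟦X⟧)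
        = 1 - C a * X := by intro a; simp
    have hprod : ∀ s : Finset (Fin n), ((∏ i ∈ s, (1 - Polynomial.C (y i) * Polynomial.X) :
        Polynomial ℝ) : ℝ⟦X⟧) = ∏ i ∈ s, (1 - C (y i) * X) := by
      intro s
      rw [← Polynomial.coeToPowerSeries.ringHom_apply, map_prod]
      simp
    have hsum : ((∑ k, Polynomial.C (l k) * ∏ i ∈ Finset.univ.erase k,
        (1 - Polynomial.C (y i) * Polynomial.X) : Polynomial ℝ) : ℝ⟦X⟧) =
        ∑ k, C (l k) * ∏ i ∈ Finset.univ.erase k, (1 - C (y i) * X) := by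
      rw [← Polynomial.coeToPowerSeries.ringHom_apply, map_sum]
      refine Finset.sum_congr rfl fun k _ => ?_
      rw [Polynomial.coeToPowerSeries.ringHom_apply, Polynomial.coe_mul, hprod,
        Polynomial.coe_C]
    rw [hP, Polynomial.coe_sub, Polynomial.coe_mul, hprod, hcoe, hsum, hQ, hD, sub_mul,
      ← mul_assoc, geomSeries_mul, one_mul, Finset.sum_mul, Finset.mul_sum]
    congr 1
    refine Finset.sum_congr rfl fun k _ => ?_
    rw [← Finset.mul_prod_erase _ _ (Finset.mem_univ k)]
    linear_combination (C (l k) * (1 - C Y * X) *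
      ∏ i ∈ Finset.univ.erase k, (1 - C (y i) * X)) * geomSeries_mul (y k)
  obtain ⟨R, hR⟩ := X_pow_dvd_iff.2 hQlt
  have hD0 : constantCoeff D = 1 := by simp [hD]
  have hPeq : (P : ℝ⟦X⟧) = C (∏ k, (Y - y k)) * X ^ n := by
    ext m
    rw [coeff_C_mul, coeff_X_pow]
    rcases lt_trichotomy m n with hm | hm | hm
    · rw [← hQD, hR, mul_assoc, coeff_X_pow_mul', if_neg (by omega), if_neg (by omega), mul_zero]
    · have h1 : coeff n Q = constantCoeff R := by
        rw [hR, coeff_X_pow_mul', if_pos le_rfl]; simp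
      rw [← hQD, hR, mul_assoc, coeff_X_pow_mul', if_pos hm.ge, if_pos hm, hm, Nat.sub_self,
        mul_one, ← hQn, h1]
      simp [hD0]
    · rw [Polynomial.coeff_coe, Polynomial.coeff_eq_zero_of_natDegree_lt (by omega),
        if_neg (by omega), mul_zero]
  have hDinv : D * (geomSeries Y * ∏ k, geomSeries (y k)) = 1 := by
    have : (∏ k, (1 - C (y k) * X)) * ∏ k, geomSeries (y k) = 1 := by
      rw [← Finset.prod_mul_distrib]
      exact Finset.prod_eq_one fun k _ => by rw [mul_comm, geomSeries_mul]
    rw [hD]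
    linear_combination (geomSeries Y * (1 - C Y * X)) * this + geomSeries_mul Y
  have hfin : Q = C (∏ k, (Y - y k)) * (X ^ n * (geomSeries Y * ∏ k, geomSeries (y k))) := by
    calc Q = Q * D * (geomSeries Y * ∏ k, geomSeries (y k)) := by rw [mul_assoc, hDinv, mul_one]
      _ = _ := by rw [hQD, hPeq]; ring
  rw [← hQc, hfin, coeff_C_mul]

end Geometric

/-! ### A submultiplicative weighted `ℓ¹` bound on power series -/

section WeightedL1

open PowerSeries

/-- All partial sums of `∑ |Fₘ| sᵐ` are at most `M`. -/
def L1Bound (s : ℝ) (F : ℝ⟦X⟧) (M : ℝ) : Prop :=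
  ∀ N : ℕ, ∑ m ∈ Finset.range N, |coeff m F| * s ^ m ≤ M

/-- The triangle of index pairs with sum below `N` lies in the square `N × N`, whose sum factors. -/
lemma L1Bound.mul {s : ℝ} (hs : 0 ≤ s) {F G : ℝ⟦X⟧} {A B : ℝ} (hF : L1Bound s F A)
    (hG : L1Bound s G B) : L1Bound s (F * G) (A * B) := by
  intro N
  set f : ℕ × ℕ → ℝ := fun p => (|coeff p.1 F| * s ^ p.1) * (|coeff p.2 G| * s ^ p.2) with hf
  have hf0 : ∀ p, 0 ≤ f p := fun p => by positivity
  have hA : 0 ≤ A := by simpa using hF 0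
  calc ∑ m ∈ Finset.range N, |coeff m (F * G)| * s ^ m
      ≤ ∑ m ∈ Finset.range N, ∑ p ∈ Finset.HasAntidiagonal.antidiagonal m, f p := by
        refine Finset.sum_le_sum fun m _ => ?_
        rw [coeff_mul]
        calc _ ≤ (∑ p ∈ Finset.HasAntidiagonal.antidiagonal m, |coeff p.1 F * coeff p.2 G|) * s ^ m := by
              gcongr; exact Finset.abs_sum_le_sum_abs _ _
          _ = _ := by
              rw [Finset.sum_mul]
              refine Finset.sum_congr rfl fun p hp => ?_
              rw [← Finset.HasAntidiagonal.mem_antidiagonal.1 hp, pow_add, abs_mul, hf]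
              ring
    _ = ∑ p ∈ (Finset.range N ×ˢ Finset.range N) with p.1 + p.2 ∈ Finset.range N, f p := by
        rw [← Finset.sum_fiberwise_of_maps_to (t := Finset.range N) (g := fun p : ℕ × ℕ => p.1 + p.2)
          (by intro p hp; exact (Finset.mem_filter.1 hp).2)]
        refine Finset.sum_congr rfl fun m hm => Finset.sum_congr ?_ fun _ _ => rfl
        ext p
        simp only [Finset.HasAntidiagonal.mem_antidiagonal, Finset.mem_filter, Finset.mem_product,
          Finset.mem_range] at hm ⊢
        omega
    _ ≤ ∑ p ∈ Finset.range N ×ˢ Finset.range N, f p :=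
        Finset.sum_le_sum_of_subset_of_nonneg (Finset.filter_subset _ _) fun p _ _ => hf0 p
    _ = (∑ m ∈ Finset.range N, |coeff m F| * s ^ m) *
          ∑ m ∈ Finset.range N, |coeff m G| * s ^ m := by
        rw [Finset.sum_product, Finset.sum_mul_sum]
    _ ≤ A * B := by
        exact mul_le_mul (hF N) (hG N) (Finset.sum_nonneg fun _ _ => by positivity) hA

lemma L1Bound.one (s : ℝ) : L1Bound s 1 1 := by
  intro N
  calc _ ≤ ∑ m ∈ Finset.range N, if m = 0 then (1 : ℝ) else 0 := by
        refine Finset.sum_le_sum fun m _ => ?_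
        rw [coeff_one]; split_ifs with h <;> simp [h]
    _ ≤ 1 := by
        rw [Finset.sum_ite_eq']; split_ifs <;> norm_num

lemma L1Bound.prod {s : ℝ} (hs : 0 ≤ s) {ι : Type*} (t : Finset ι) {F : ι → ℝ⟦X⟧} {A : ι → ℝ}
    (h : ∀ i ∈ t, L1Bound s (F i) (A i)) : L1Bound s (∏ i ∈ t, F i) (∏ i ∈ t, A i) := by
  classical
  induction t using Finset.induction_on with
  | empty => simpa using L1Bound.one s
  | insert i t hi ih =>
    rw [Finset.prod_insert hi, Finset.prod_insert hi]
    exact (h i (Finset.mem_insert_self _ _)).mul hs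
      (ih fun j hj => h j (Finset.mem_insert_of_mem hj))

lemma L1Bound.mono {s : ℝ} {F : ℝ⟦X⟧} {A B : ℝ} (h : L1Bound s F A) (hAB : A ≤ B) :
    L1Bound s F B := fun N => (h N).trans hAB

end WeightedL1

/-! ### Derangement numbers and products of geometric series -/

section Derangement

open PowerSeries

/-- The coefficients of `exp (-X) / (1 - X)`. -/
noncomputable def derangementProb (m : ℕ) : ℝ := ∑ i ∈ Finset.range (m + 1), (-1) ^ i / (i ! : ℝ)

lemma derangementProb_add_two (m : ℕ) : (m + 2 : ℝ) * derangementProb (m + 2) =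
    derangementProb m + (m + 1) * derangementProb (m + 1) := by
  have h1 : derangementProb (m + 1) = derangementProb m + (-1) ^ (m + 1) / ((m + 1)! : ℝ) :=
    Finset.sum_range_succ _ _
  have h2 : derangementProb (m + 2) = derangementProb (m + 1) + (-1) ^ (m + 2) / ((m + 2)! : ℝ) :=
    Finset.sum_range_succ _ _
  rw [h2, h1, Nat.factorial_succ (m + 1)]
  push_cast
  field_simp
  ring

/-- Each value is a convex combination of the two preceding ones, so an interval containing two
consecutive values contains all later ones. The start is at index 1 because the value at 0 is 1. -/
lemma derangementProb_mem_Icc (m : ℕ) : derangementProb (m + 1) ∈ Set.Icc (0 : ℝ) (1 / 2) ∧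
    derangementProb (m + 2) ∈ Set.Icc (0 : ℝ) (1 / 2) := by
  induction m with
  | zero => constructor <;> norm_num [derangementProb, Finset.sum_range_succ, Nat.factorial]
  | succ m ih =>
    obtain ⟨⟨h1, h2⟩, h3, h4⟩ := ih
    refine ⟨⟨h3, h4⟩, ?_⟩
    have h := derangementProb_add_two (m + 1)
    push_cast at h
    have hm : (0 : ℝ) ≤ m := m.cast_nonneg
    constructor
    · have : 0 ≤ (m + 1 + 2 : ℝ) * derangementProb (m + 1 + 2) := by rw [h]; positivity
      exact nonneg_of_mul_nonneg_right this (by positivity)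
    · have : (m + 1 + 2 : ℝ) * derangementProb (m + 1 + 2) ≤ (m + 1 + 2 : ℝ) * (1 / 2) := by
        rw [h]
        nlinarith [mul_le_mul_of_nonneg_left h4 (by positivity : (0 : ℝ) ≤ m + 1 + 1)]
      exact le_of_mul_le_mul_left this (by positivity)

/-- The series `exp (-a X) / (1 - a X)`. -/
noncomputable def expGeomSeries (a : ℝ) : ℝ⟦X⟧ := rescale (-a) (exp ℝ) * geomSeries a

lemma coeff_expGeomSeries (a : ℝ) (m : ℕ) :
    coeff m (expGeomSeries a) = a ^ m * derangementProb m := by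
  rw [expGeomSeries, coeff_mul, Finset.Nat.sum_antidiagonal_eq_sum_range_succ_mk, derangementProb,
    Finset.mul_sum]
  refine Finset.sum_congr rfl fun i hi => ?_
  have hi' : i ≤ m := by simpa [Nat.lt_succ_iff] using hi
  rw [coeff_rescale, coeff_exp, coeff_geomSeries, ← Nat.sub_add_cancel hi', pow_add,
    Nat.add_sub_cancel, neg_pow]
  simp
  ring

lemma prod_geomSeries_eq {ι : Type*} (t : Finset ι) (a : ι → ℝ) :
    rescale (-∑ i ∈ t, a i) (exp ℝ) * ∏ i ∈ t, geomSeries (a i) = ∏ i ∈ t, expGeomSeries (a i) := by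
  classical
  induction t using Finset.induction_on with
  | empty => simp [rescale_zero]
  | insert i t hi ih =>
    rw [Finset.prod_insert hi, Finset.prod_insert hi, Finset.sum_insert hi, ← ih, expGeomSeries,
      neg_add, ← exp_mul_exp_eq_exp_add]
    ring

/-- The constant term is 1, the linear term 0 and the later derangement factors at most 1/2, so the
sum is at most `1 + r²/(2(1 - r))` with `r = |a|s`. -/
lemma l1Bound_expGeomSeries {a s ρ : ℝ} (hs : 0 ≤ s) (ha : |a| * s ≤ ρ) (hρ : ρ < 1) :
    L1Bound s (expGeomSeries a) (Real.exp (a ^ 2 * (s ^ 2 / (2 * (1 - ρ))))) := by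
  set r := |a| * s with hr
  have hr0 : 0 ≤ r := by positivity
  have hr1 : r < 1 := ha.trans_lt hρ
  have hterm : ∀ m, |coeff m (expGeomSeries a)| * s ^ m = r ^ m * |derangementProb m| := by
    intro m
    rw [coeff_expGeomSeries, abs_mul, abs_pow, hr, mul_pow]; ring
  have hb0 : derangementProb 0 = 1 := by simp [derangementProb]
  have hb1 : derangementProb 1 = 0 := by simp [derangementProb, Finset.sum_range_succ]
  have hmain : ∀ N : ℕ, ∑ m ∈ Finset.range (N + 2), |coeff m (expGeomSeries a)| * s ^ m ≤
      1 + r ^ 2 / (2 * (1 - r)) := by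
    intro N
    simp only [hterm]
    rw [Finset.sum_range_succ', Finset.sum_range_succ', hb0, hb1]
    have hg : ∑ m ∈ Finset.range N, r ^ m ≤ (1 - r)⁻¹ := by
      rw [← tsum_geometric_of_lt_one hr0 hr1]
      exact (summable_geometric_of_lt_one hr0 hr1).sum_le_tsum _ fun _ _ => by positivity
    have : ∑ m ∈ Finset.range N, r ^ (m + 1 + 1) * |derangementProb (m + 1 + 1)| ≤
        r ^ 2 / 2 * ∑ m ∈ Finset.range N, r ^ m := by
      rw [Finset.mul_sum]
      refine Finset.sum_le_sum fun m _ => ?_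
      have h := (derangementProb_mem_Icc m).2
      rw [abs_of_nonneg h.1]
      calc _ ≤ r ^ (m + 1 + 1) * (1 / 2) := by gcongr; exact h.2
        _ = _ := by ring
    have h3 : r ^ 2 / 2 * ∑ m ∈ Finset.range N, r ^ m ≤ r ^ 2 / (2 * (1 - r)) := by
      calc _ ≤ r ^ 2 / 2 * (1 - r)⁻¹ := by gcongr
        _ = _ := by rw [← div_eq_mul_inv, div_div]
    simp only [abs_zero, abs_one]
    linarith
  intro N
  calc _ ≤ ∑ m ∈ Finset.range (N + 2), |coeff m (expGeomSeries a)| * s ^ m :=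
        Finset.sum_le_sum_of_subset_of_nonneg (by simp) fun _ _ _ => by positivity
    _ ≤ 1 + r ^ 2 / (2 * (1 - r)) := hmain N
    _ ≤ 1 + r ^ 2 / (2 * (1 - ρ)) := by
        have : 0 < 1 - ρ := by linarith
        gcongr
    _ ≤ Real.exp (r ^ 2 / (2 * (1 - ρ))) := by rw [add_comm]; exact Real.add_one_le_exp _
    _ = _ := by rw [hr, mul_pow, sq_abs, mul_div_assoc]

/-- If the `yᵢ` have mean zero, the linear term of `∏ 1 / (1 - yᵢ X)` vanishes, which improves the
bound on its coefficients. -/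
lemma l1Bound_prod_geomSeries {ι : Type*} (t : Finset ι) {y : ι → ℝ} (hy : ∑ i ∈ t, y i = 0)
    {s ρ : ℝ} (hs : 0 ≤ s) (hρ : ρ < 1) (h : ∀ i ∈ t, |y i| * s ≤ ρ) :
    L1Bound s (∏ i ∈ t, geomSeries (y i))
      (Real.exp ((∑ i ∈ t, y i ^ 2) * (s ^ 2 / (2 * (1 - ρ))))) := by
  have he := prod_geomSeries_eq t y
  rw [hy, neg_zero, rescale_zero] at he
  simp only [RingHom.comp_apply, constantCoeff_exp, map_one, one_mul] at he
  rw [he, Finset.sum_mul, Real.exp_sum]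
  exact L1Bound.prod hs t fun i hi => l1Bound_expGeomSeries hs (h i hi) hρ

end Derangement

/-! ### Error of centred, exponentially weighted interpolation -/

section UpperBound

open PowerSeries

lemma eval_lagrange_basis_sub {n : ℕ} (v : Fin n → ℝ) (k : Fin n) (Y c : ℝ) :
    (Lagrange.basis Finset.univ (fun i => v i - c) k).eval (Y - c) =
      (Lagrange.basis Finset.univ v k).eval Y := by
  simp [Lagrange.basis, Lagrange.basisDivisor, Polynomial.eval_prod]

lemma sum_sub_mean_sq_le {ι : Type*} [Fintype ι] {z : ι → ℝ} (hz : ∀ i, |z i| ≤ 1)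
    {c : ℝ} (hc : ∑ i, (z i - c) = 0) :
    ∑ i, (z i - c) ^ 2 ≤ Fintype.card ι * (1 - c ^ 2) := by
  have h : ∑ i, (z i - c) ^ 2 = ∑ i, (z i ^ 2 - c ^ 2 - 2 * c * (z i - c)) :=
    Finset.sum_congr rfl fun i _ => by ring
  rw [h, Finset.sum_sub_distrib, ← Finset.mul_sum, hc, mul_zero, sub_zero]
  calc _ ≤ ∑ i : ι, (1 - c ^ 2) := by
        refine Finset.sum_le_sum fun i _ => ?_
        have := (sq_le_one_iff_abs_le_one (z i)).2 (hz i)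
        linarith
    _ = _ := by simp; ring

/-- The inequality `(n + m)! ≥ n! (n + 1)^m` makes the weights geometric with ratio `ε/(n + 1)`, and
then `ℓ² ≤ ℓ¹`. -/
lemma sum_pow_div_factorial_mul_coeff_sq_le {ε : ℝ} (hε : 0 ≤ ε) (n : ℕ) {G : ℝ⟦X⟧} {M : ℝ}
    (hG : L1Bound √(ε / (n + 1)) G M) (N : ℕ) :
    ∑ j ∈ Finset.range N, ε ^ j / j ! * coeff j (X ^ n * G) ^ 2 ≤ ε ^ n / n ! * M ^ 2 := by
  set s := √(ε / (n + 1)) with hs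
  have hs2 : s ^ 2 = ε / (n + 1) := Real.sq_sqrt (by positivity)
  have hs0 : 0 ≤ s := Real.sqrt_nonneg _
  calc _ ≤ ∑ j ∈ Finset.range (n + N), ε ^ j / j ! * coeff j (X ^ n * G) ^ 2 :=
        Finset.sum_le_sum_of_subset_of_nonneg (by simp) fun _ _ _ => by positivity
    _ = ∑ m ∈ Finset.range N, ε ^ (n + m) / (n + m)! * coeff m G ^ 2 := by
        rw [Finset.sum_range_add, Finset.sum_eq_zero, zero_add]
        · refine Finset.sum_congr rfl fun m _ => ?_
          rw [coeff_X_pow_mul', if_pos (by omega), Nat.add_sub_cancel_left]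
        · intro j hj
          rw [coeff_X_pow_mul', if_neg (by simpa using hj)]; simp
    _ ≤ ∑ m ∈ Finset.range N, ε ^ n / n ! * (|coeff m G| * s ^ m) ^ 2 := by
        refine Finset.sum_le_sum fun m _ => ?_
        have hf : (n ! : ℝ) * (n + 1) ^ m ≤ (n + m)! := by
          exact_mod_cast Nat.factorial_mul_pow_le_factorial
        rw [mul_pow, sq_abs, pow_right_comm, hs2, div_pow]
        calc _ ≤ ε ^ (n + m) / (n ! * (n + 1) ^ m) * coeff m G ^ 2 := by gcongr
          _ = _ := by rw [pow_add]; field_simp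
    _ ≤ _ := by
        rw [← Finset.mul_sum]
        gcongr
        calc _ ≤ (∑ m ∈ Finset.range N, |coeff m G| * s ^ m) ^ 2 :=
              Finset.sum_sq_le_sq_sum_of_nonneg fun _ _ => by positivity
          _ ≤ _ := by
              have := hG N
              gcongr

/-- With `a = |c|`, the variance factor `1 - c²` offsets the small denominator `1 - ρ`, `ρ = (1 +
|c|)s`, that arises when the mean is near an endpoint. -/
lemma one_sub_sq_le_mul {s a : ℝ} (hs : 0 ≤ s) (hs5 : s ^ 2 ≤ 1 / 5) (ha1 : a ≤ 1) :
    (1 + a) * s < 1 ∧ 1 - a ^ 2 ≤ 12 / 5 * (1 - (1 + a) * s) := by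
  have h : s ≤ 0.4473 := by nlinarith
  constructor
  · nlinarith
  · nlinarith [sq_nonneg (a - 6 / 5 * s)]

/-- Exponentially weighted polynomial interpolation, centred at the mean of the nodes and the
evaluation point. -/
noncomputable def weightedInterp (ε : ℝ) {n : ℕ} (x : Fin n → Dom) (hx : Function.Injective x) :
    LinApprox n where
  point := x
  point_injective := hx
  weight k y := Real.exp (ε * (((y : ℝ) + ∑ i, (x i : ℝ)) / (n + 1)) * (y - x k)) *
    (Lagrange.basis Finset.univ (fun i => (x i : ℝ)) k).eval (y : ℝ)
  weight_measurable k := by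
    refine Measurable.nullMeasurable (Continuous.measurable ?_)
    have := (Lagrange.basis Finset.univ (fun i => (x i : ℝ)) k).continuous
    fun_prop

/-- The exponent is `17/5 = 1 + 2 · 6/5`: the 1 comes from `2cy - c² ≤ y² ≤ 1`, and `6/5` from the
`ℓ¹` bound, which enters squared. -/
lemma norm_errorRep_weightedInterp_sq_le {ε : ℝ} (hε : 0 ≤ ε)
    [Fact (kernelMatrix (expKernel ε)).PosSemidef] {n : ℕ} (hn : 5 * ε ≤ n) {x : Fin n → Dom}
    (hx : Function.Injective x) (y : Dom) :
    ‖(weightedInterp ε x hx).errorRep (expKernel ε) y‖ ^ 2 ≤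
      (∏ k, ((y : ℝ) - x k)) ^ 2 * (ε ^ n / n !) * Real.exp (17 / 5 * ε) := by
  set c : ℝ := ((y : ℝ) + ∑ i, (x i : ℝ)) / (n + 1) with hc
  set z : Option (Fin n) → ℝ := fun i => i.elim (y : ℝ) fun k => (x k : ℝ) with hz
  have hz1 : ∀ i, |z i| ≤ 1 := by
    rintro (_ | k)
    · exact abs_le.2 y.2
    · exact abs_le.2 (x k).2
  have hn0 : (0 : ℝ) < n + 1 := by positivity
  have hsum0 : ∑ i, (z i - c) = 0 := by
    simp only [Finset.sum_sub_distrib, Fintype.sum_option, hz, Option.elim]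
    simp [hc]
    field_simp
    ring
  have hc1 : |c| ≤ 1 := by
    have : c = (∑ i, z i) / (n + 1) := by simp [hc, hz, Fintype.sum_option]
    rw [this, abs_div, abs_of_pos hn0, div_le_one hn0]
    calc _ ≤ ∑ i, |z i| := Finset.abs_sum_le_sum_abs _ _
      _ ≤ ∑ i : Option (Fin n), (1 : ℝ) := Finset.sum_le_sum fun i _ => hz1 i
      _ = n + 1 := by simp
  have hvar : ∑ i, (z i - c) ^ 2 ≤ (n + 1) * (1 - c ^ 2) := by
    simpa using sum_sub_mean_sq_le hz1 hsum0
  set s := √(ε / (n + 1)) with hs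
  have hs2 : s ^ 2 = ε / (n + 1) := Real.sq_sqrt (by positivity)
  have hs0 : 0 ≤ s := Real.sqrt_nonneg _
  obtain ⟨hρ, hκ⟩ := one_sub_sq_le_mul (a := |c|) hs0
    (by rw [hs2, div_le_div_iff₀ hn0 (by norm_num)]; linarith) hc1
  set ρ := (1 + |c|) * s with hρdef
  set G : ℝ⟦X⟧ := ∏ i, geomSeries (z i - c) with hG
  have hL := l1Bound_prod_geomSeries Finset.univ hsum0 hs0 hρ fun i _ => by
    have : |z i - c| ≤ 1 + |c| := (abs_sub (z i) c).trans (by have := hz1 i; linarith)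
    exact mul_le_mul_of_nonneg_right this hs0
  have hL' : L1Bound s G (Real.exp (6 / 5 * ε)) := by
    refine hL.mono (Real.exp_le_exp.2 ?_)
    have hρ' : 0 < 1 - ρ := by linarith
    rw [sq_abs] at hκ
    calc _ ≤ ((n + 1) * (1 - c ^ 2)) * (s ^ 2 / (2 * (1 - ρ))) := by gcongr
      _ ≤ ((n + 1) * (12 / 5 * (1 - ρ))) * (s ^ 2 / (2 * (1 - ρ))) := by gcongr
      _ = _ := by rw [hs2]; field_simp; ring
  have hterm := hasSum_norm_kerComb_expKernel (ε := ε)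
    (fun i : Option (Fin n) => i.elim y x)
    (fun i : Option (Fin n) => i.elim 1 fun k => - (weightedInterp ε x hx).weight k y) c
  refine le_of_tendsto' hterm.tendsto_sum_nat fun N => ?_
  -- The tilt in the weights turns `exp(εc xₖ)` into the common factor `exp(εcy)`, leaving a pure
  -- interpolation remainder.
  have hcomb : ∀ j : ℕ, (∑ i : Option (Fin n),
      (i.elim 1 fun k => - (weightedInterp ε x hx).weight k y : ℝ) *
      Real.exp (ε * c * ((i.elim y x : Dom) : ℝ)) * (((i.elim y x : Dom) : ℝ) - c) ^ j) =
      Real.exp (ε * c * y) * ((∏ k, ((y : ℝ) - x k)) * coeff j (X ^ n * G)) := by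
    intro j
    have hinj : Function.Injective fun k => (x k : ℝ) - c := fun a b h => by
      simpa [Subtype.coe_inj, hx.eq_iff] using h
    have h := pow_sub_lagrange_eq hinj ((y : ℝ) - c) j
    simp only [sub_sub_sub_cancel_right, eval_lagrange_basis_sub (fun i => (x i : ℝ))] at h
    rw [hG, Fintype.prod_option]
    simp only [hz, Option.elim]
    rw [← h, Fintype.sum_option]
    simp only [one_mul, weightedInterp]
    rw [mul_sub, Finset.mul_sum, eq_sub_iff_add_eq, add_assoc, ← Finset.sum_add_distrib,
      Finset.sum_eq_zero, add_zero]
    intro k _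
    have : Real.exp (ε * c * y) = Real.exp (ε * c * (y - x k)) * Real.exp (ε * c * x k) := by
      rw [← Real.exp_add]; congr 1; ring
    rw [this]
    ring
  simp only [hcomb]
  have hfac : ∀ j : ℕ, Real.exp (-(ε * c ^ 2)) * (ε ^ j / j !) *
      (Real.exp (ε * c * y) * ((∏ k, ((y : ℝ) - x k)) * coeff j (X ^ n * G))) ^ 2 =
      Real.exp (ε * (2 * c * y - c ^ 2)) * (∏ k, ((y : ℝ) - x k)) ^ 2 *
        (ε ^ j / j ! * coeff j (X ^ n * G) ^ 2) := by
    intro j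
    have : Real.exp (ε * (2 * c * y - c ^ 2)) =
        Real.exp (-(ε * c ^ 2)) * Real.exp (ε * c * y) ^ 2 := by
      rw [← Real.exp_nat_mul, ← Real.exp_add]; congr 1; push_cast; ring
    rw [this]; ring
  simp only [hfac]
  rw [← Finset.mul_sum]
  have hy : (y : ℝ) ^ 2 ≤ 1 := (sq_le_one_iff_abs_le_one _).2 (abs_le.2 y.2)
  calc _ ≤ Real.exp ε * (∏ k, ((y : ℝ) - x k)) ^ 2 *
        (ε ^ n / n ! * Real.exp (6 / 5 * ε) ^ 2) := by
        gcongr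
        · nlinarith [sq_nonneg (c - y)]
        · exact sum_pow_div_factorial_mul_coeff_sq_le hε n hL' N
    _ = _ := by
        have : Real.exp (17 / 5 * ε) = Real.exp ε * Real.exp (6 / 5 * ε) ^ 2 := by
          rw [← Real.exp_nat_mul, ← Real.exp_add]; congr 1; push_cast; ring
        rw [this]; ring

end UpperBound

/-! ### Absorbing `exp(17ε/5)` into the stated constants -/

section Constants

lemma nine_le_mul_of_mL_le {t : ℝ} (ht : 0 < t) {n : ℝ} (hn : mL t ≤ n) : 9 ≤ t * n := by
  have : 9 / t ≤ n := (le_max_right _ _).trans hn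
  rw [div_le_iff₀ ht] at this; linarith

lemma five_mul_le_of_mL_le {t : ℝ} {n : ℝ} (hn : mL t ≤ n) : 5 * t ≤ n :=
  (le_max_left _ _).trans ((le_max_left _ _).trans hn)

/-- Here `49/10 = 17/5 + 3/2`, and `7/4` leaves `1/4` of the exponent `2√(tn)` for the algebraic
prefactor. The three terms of `mL` serve the ranges `t ≤ 1` (`9/t`), `1 ≤ t ≤ 4` (`5t`) and `t ≥ 4`.
-/
lemma exponent_le {t n : ℝ} (ht : 0 < t) (hn : mL t ≤ n) :
    49 / 10 * t ≤ 2 * √t + 7 / 4 * √(t * n) := by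
  have h9 := nine_le_mul_of_mL_le ht hn
  have h5 := five_mul_le_of_mL_le hn
  have hq : t * (1 + t / 2) ^ 2 ≤ n := (le_max_right _ _).trans ((le_max_left _ _).trans hn)
  have hst : 0 ≤ √t := Real.sqrt_nonneg t
  rcases le_total t 1 with h1 | h1
  · have : 3 ≤ √(t * n) := Real.le_sqrt_of_sq_le (by linarith)
    linarith
  rcases le_total t 4 with h4 | h4
  · have hu : 2.236 * t ≤ √(t * n) := Real.le_sqrt_of_sq_le (by nlinarith)
    -- Chord of the concave square root between 1 and 4.
    have hr : (t + 2) / 3 ≤ √t := Real.le_sqrt_of_sq_le (by nlinarith)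
    linarith
  · have hu : t * (1 + t / 2) ≤ √(t * n) := Real.le_sqrt_of_sq_le (by nlinarith)
    nlinarith

lemma le_cL {t : ℝ} (ht : 0 < t) :
    Real.exp (-(3 / 2) * t + 2 * √t) * 2 / (√Real.pi * t ^ (1 / 4 : ℝ)) ≤ cL t := by
  have hπe : 1 ≤ √(Real.pi / Real.exp 1) := by
    rw [Real.one_le_sqrt, one_le_div (Real.exp_pos 1)]
    linarith [Real.pi_gt_three, Real.exp_one_lt_d9]
  have h4 : (4 : ℝ) ≤ 3 + √(Real.pi / Real.exp 1) + 2 / (√Real.pi * t ^ (1 / 4 : ℝ)) +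
      7 / (16 * √t) + √t * (2 + t) := by
    have h1 : 0 ≤ 2 / (√Real.pi * t ^ (1 / 4 : ℝ)) := by positivity
    have h2 : 0 ≤ 7 / (16 * √t) := by positivity
    have h3 : 0 ≤ √t * (2 + t) := by positivity
    linarith
  rw [cL]
  calc _ = Real.exp (-(3 / 2) * t + 2 * √t) / (2 * √Real.pi * t ^ (1 / 4 : ℝ)) * 4 := by
        field_simp; ring
    _ ≤ _ := by gcongr

lemma cL_nonneg {t : ℝ} (ht : 0 < t) : 0 ≤ cL t := le_trans (by positivity) (le_cL ht)

lemma exp_le_cL_mul {t n : ℝ} (ht : 0 < t) (hn : mL t ≤ n) :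
    Real.exp (17 / 5 * t) ≤ cL t * n ^ (-(1 / 4) : ℝ) * Real.exp √(t * n) ^ 2 := by
  have hn0 : 0 < n := lt_of_lt_of_le (by positivity) (five_mul_le_of_mL_le hn)
  set u := √(t * n) with hu
  have hu0 : 0 < u := Real.sqrt_pos.2 (by positivity)
  have hquart : t ^ (1 / 4 : ℝ) * n ^ (1 / 4 : ℝ) = √u := by
    rw [← Real.mul_rpow ht.le hn0.le, hu, Real.sqrt_eq_rpow, Real.sqrt_eq_rpow,
      ← Real.rpow_mul (by positivity)]
    norm_num
  -- After squaring, this follows from `exp(u/2) ≥ e·u/2` and `π ≤ 2e`.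
  have hπu : √Real.pi * √u ≤ 2 * Real.exp (u / 4) := by
    rw [← Real.sqrt_mul Real.pi_pos.le]
    refine Real.sqrt_le_iff.2 ⟨by positivity, ?_⟩
    have h1 : u / 2 - 1 + 1 ≤ Real.exp (u / 2 - 1) := Real.add_one_le_exp _
    have h2 : Real.exp (u / 4) ^ 2 = Real.exp (u / 2 - 1) * Real.exp 1 := by
      rw [← Real.exp_nat_mul, ← Real.exp_add]; congr 1; push_cast; ring
    rw [mul_pow, h2]
    have h3 := Real.exp_one_gt_d9
    have h4 := Real.pi_lt_four
    nlinarith [Real.exp_pos (u / 2 - 1), Real.exp_pos 1]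
  calc Real.exp (17 / 5 * t) ≤ Real.exp (-(3 / 2) * t + 2 * √t + 7 / 4 * u) :=
        Real.exp_le_exp.2 (by linarith [exponent_le ht hn])
    _ = Real.exp (-(3 / 2) * t + 2 * √t) * Real.exp u ^ 2 / Real.exp (u / 4) := by
        rw [eq_div_iff (Real.exp_pos _).ne', ← Real.exp_nat_mul, ← Real.exp_add, ← Real.exp_add]
        congr 1; push_cast; ring
    _ = Real.exp (-(3 / 2) * t + 2 * √t) * 2 * Real.exp u ^ 2 / (2 * Real.exp (u / 4)) := by
        field_simp
    _ ≤ Real.exp (-(3 / 2) * t + 2 * √t) * 2 * Real.exp u ^ 2 / (√Real.pi * √u) := by gcongr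
    _ = Real.exp (-(3 / 2) * t + 2 * √t) * 2 / (√Real.pi * t ^ (1 / 4 : ℝ)) *
          n ^ (-(1 / 4) : ℝ) * Real.exp u ^ 2 := by
        rw [← hquart, Real.rpow_neg hn0.le]; field_simp
    _ ≤ _ := by gcongr; exact le_cL ht

lemma rpow_neg_half_sq {a : ℝ} (ha : 0 ≤ a) : (a ^ (-(1 / 2) : ℝ)) ^ 2 = a⁻¹ := by
  rw [← Real.rpow_natCast, ← Real.rpow_mul ha]; norm_num [Real.rpow_neg_one]

lemma rpow_neg_eighth_sq {a : ℝ} (ha : 0 ≤ a) : (a ^ (-(1 / 8) : ℝ)) ^ 2 = a ^ (-(1 / 4) : ℝ) := by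
  rw [← Real.rpow_natCast, ← Real.rpow_mul ha]; norm_num

lemma worstCaseError_weightedInterp_le {ε : ℝ} (hε : 0 < ε) {n : ℕ} (hn : mL ε ≤ n)
    {x : Fin n → Dom} (hx : Function.Injective x) {W : ℝ}
    (hW : ∀ y : Dom, |∏ k, ((y : ℝ) - x k)| ≤ W) :
    worstCaseError (expKernel ε) (expKernel_posSemidef hε.le) (weightedInterp ε x hx) ≤
      ENNReal.ofReal (W * (√(cL ε) * (n : ℝ) ^ (-(1 / 8) : ℝ) * Real.exp √(ε * n) * √ε ^ n *
        (n ! : ℝ) ^ (-(1 / 2) : ℝ))) := by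
  have : Fact (kernelMatrix (expKernel ε)).PosSemidef := ⟨expKernel_posSemidef hε.le⟩
  refine errorOn_le _ fun y => ?_
  have hW0 : 0 ≤ W := (abs_nonneg _).trans (hW y)
  refine le_of_sq_le_sq ?_ (by positivity)
  refine (norm_errorRep_weightedInterp_sq_le hε.le (five_mul_le_of_mL_le hn) hx y).trans ?_
  calc _ ≤ W ^ 2 * (ε ^ n / n !) *
        (cL ε * (n : ℝ) ^ (-(1 / 4) : ℝ) * Real.exp √(ε * n) ^ 2) := by
        refine mul_le_mul (mul_le_mul_of_nonneg_right ?_ (by positivity)) (exp_le_cL_mul hε hn)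
          (by positivity) (by positivity)
        exact sq_le_sq' (abs_le.1 (hW y)).1 (abs_le.1 (hW y)).2
    _ = _ := by
        rw [mul_pow, mul_pow, mul_pow, mul_pow, mul_pow, Real.sq_sqrt (cL_nonneg hε),
          rpow_neg_half_sq (by positivity), rpow_neg_eighth_sq (by positivity), pow_right_comm,
          Real.sq_sqrt hε.le]
        ring

end Constants

/-! ### Explicit coefficients of Chebyshev polynomials -/

section ChebyshevCoefficients

open Polynomial

lemma coeff_chebyshevT_add_two (n k : ℕ) : (Chebyshev.T ℝ ((n + 2 : ℕ) : ℤ)).coeff (k + 1) =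
    2 * (Chebyshev.T ℝ ((n + 1 : ℕ) : ℤ)).coeff k -
      (Chebyshev.T ℝ (n : ℤ)).coeff (k + 1) := by
  have h := Chebyshev.T_add_two ℝ (n : ℤ)
  push_cast
  rw [h, coeff_sub, mul_assoc, ← C_ofNat, coeff_C_mul, coeff_X_mul]

lemma coeff_zero_chebyshevT_add_two (n : ℕ) : (Chebyshev.T ℝ ((n + 2 : ℕ) : ℤ)).coeff 0 =
    - (Chebyshev.T ℝ (n : ℤ)).coeff 0 := by
  have h := Chebyshev.T_add_two ℝ (n : ℤ)
  push_cast
  rw [h, coeff_sub, mul_assoc, ← C_ofNat, coeff_C_mul, coeff_X_mul_zero, mul_zero, zero_sub]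

lemma coeff_chebyshevT_of_odd (n : ℕ) : ∀ k : ℕ, Odd (n + k) →
    (Chebyshev.T ℝ (n : ℤ)).coeff k = 0 := by
  induction n using Nat.twoStepInduction with
  | zero =>
    intro k hk
    have : k ≠ 0 := by rintro rfl; simp at hk
    simp [coeff_one, this]
  | one =>
    intro k hk
    have : 1 ≠ k := by rintro rfl; exact absurd hk (by decide)
    simp [coeff_X, this]
  | more n ih1 ih2 =>
    intro k hk
    rcases k with _ | k
    · rw [coeff_zero_chebyshevT_add_two, ih1 0 (by grind), neg_zero]
    · rw [coeff_chebyshevT_add_two, ih1 _ (by grind), ih2 k (by grind)]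
      simp

lemma coeff_chebyshevT (n : ℕ) (hn : 1 ≤ n) : ∀ i k : ℕ, 2 * i + k = n →
    (Chebyshev.T ℝ (n : ℤ)).coeff k =
      (-1) ^ i * 2 ^ k * n * (i + k - 1)! / (2 * (k ! * i !)) := by
  induction n using Nat.strong_induction_on with
  | _ n ih =>
  intro i k hik
  rcases i with _ | i
  · rw [zero_add, mul_zero, zero_add] at *
    subst hik
    have h := Chebyshev.leadingCoeff_T ℝ (k : ℤ)
    rw [leadingCoeff, Chebyshev.natDegree_T, Int.natAbs_natCast] at h
    rw [h]
    obtain ⟨m, rfl⟩ : ∃ m, k = m + 1 := ⟨k - 1, by omega⟩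
    simp only [Nat.add_sub_cancel, Nat.factorial_succ]
    push_cast
    field_simp
    simp [pow_succ]
  obtain ⟨m, rfl⟩ : ∃ m, n = m + 2 := ⟨n - 2, by omega⟩
  rcases k with _ | k
  · rw [coeff_zero_chebyshevT_add_two]
    -- The formula fails for `T₀`, whose factor `n` is zero, so `T₂` is treated directly.
    rcases Nat.eq_zero_or_pos m with rfl | hm
    · have : i = 0 := by omega
      subst this
      simp
    · rw [ih m (by omega) hm i 0 (by omega)]
      obtain ⟨i, rfl⟩ : ∃ j, i = j + 1 := ⟨i - 1, by omega⟩
      have : m = 2 * (i + 1) := by omega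
      subst this
      simp only [add_zero, Nat.add_sub_cancel, Nat.factorial_succ]
      push_cast
      field_simp
      ring
  · have hm : 1 ≤ m := by omega
    rw [coeff_chebyshevT_add_two, ih (m + 1) (by omega) (by omega) (i + 1) k (by omega),
      ih m (by omega) hm i (k + 1) (by omega)]
    have : m = 2 * i + k + 1 := by omega
    subst this
    rw [show i + 1 + k - 1 = i + k by omega, show i + (k + 1) - 1 = i + k by omega,
      show i + 1 + (k + 1) - 1 = i + k + 1 by omega]
    simp only [Nat.factorial_succ]
    push_cast
    field_simp
    ring

end ChebyshevCoefficients

/-! ### Factorial inequalities -/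

section Factorials

lemma factorial_add_mul_factorial_le {a b : ℕ} (hab : a ≤ b) (d : ℕ) :
    (a + d)! * b ! ≤ a ! * (b + d)! := by
  induction d with
  | zero => simp
  | succ d ih =>
    rw [← add_assoc, ← add_assoc, Nat.factorial_succ, Nat.factorial_succ]
    calc _ = (a + d + 1) * ((a + d)! * b !) := by ring
      _ ≤ (b + d + 1) * (a ! * (b + d)!) := by gcongr
      _ = _ := by ring

/-- Controls the squared coefficient of `Tₙ` at degree `n - 2i`. It rests on the log-convexity of
factorials and on `n ≤ (1 + 2i/n)(n - i)`, which holds since the difference is `i(n - 2i)/n`. -/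
lemma mul_factorial_sq_le {n i : ℕ} (hn : 1 ≤ n) (hi : 2 * i ≤ n) :
    (n : ℝ) ^ 2 * ((n - i - 1)! : ℝ) ^ 2 ≤ (1 + 2 / n) * (n ! * (n - 2 * i)! * i !) := by
  have hn0 : (0 : ℝ) < n := by exact_mod_cast hn
  have hi0 : (0 : ℝ) ≤ i := i.cast_nonneg
  have hi2 : 2 * (i : ℝ) ≤ n := by exact_mod_cast hi
  have hni : (0 : ℝ) < n - i := by linarith
  have h1 : (n - i - 1)! * (n - i)! ≤ (n - 2 * i)! * (n - 1)! := by
    rcases Nat.eq_zero_or_pos i with rfl | hi1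
    · simp [mul_comm]
    · have := factorial_add_mul_factorial_le (a := n - 2 * i) (b := n - i) (by omega) (i - 1)
      rwa [show n - 2 * i + (i - 1) = n - i - 1 by omega,
        show n - i + (i - 1) = n - 1 by omega] at this
  have h2 : ((n - i)! : ℝ) = (n - i) * (n - i - 1)! := by
    rw [← Nat.mul_factorial_pred (by omega : n - i ≠ 0)]
    push_cast [Nat.cast_sub (by omega : i ≤ n)]
    ring
  have h3 : (n ! : ℝ) = n * (n - 1)! := by
    rw [← Nat.mul_factorial_pred (by omega : n ≠ 0)]; push_cast; ring
  have h1' : ((n - i - 1)! : ℝ) * ((n - i) * (n - i - 1)!) ≤ (n - 2 * i)! * (n - 1)! := by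
    rw [← h2]; exact_mod_cast h1
  have h4 : (n : ℝ) ≤ (1 + 2 / n) * i ! * (n - i) := by
    have hf1 : (1 : ℝ) ≤ i ! := by exact_mod_cast Nat.one_le_iff_ne_zero.2 (Nat.factorial_ne_zero i)
    have hfi : (i : ℝ) ≤ i ! := by exact_mod_cast Nat.self_le_factorial i
    calc (n : ℝ) ≤ (1 + 2 / n * i) * (n - i) := by
          have : (1 + 2 / n * i) * (n - i) - n = i * (n - 2 * i) / (n : ℝ) := by
            field_simp; ring
          have h : 0 ≤ i * (n - 2 * i) / (n : ℝ) :=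
            div_nonneg (mul_nonneg hi0 (by linarith)) hn0.le
          linarith
      _ ≤ (1 * i ! + 2 / n * i !) * (n - i) := by gcongr; linarith
      _ = _ := by ring
  refine le_of_mul_le_mul_right ?_ hni
  calc (n : ℝ) ^ 2 * ((n - i - 1)! : ℝ) ^ 2 * ((n : ℝ) - i)
      = (n : ℝ) ^ 2 * (((n - i - 1)! : ℝ) * (((n : ℝ) - i) * (n - i - 1)!)) := by ring
    _ ≤ (n : ℝ) ^ 2 * (((n - 2 * i)! : ℝ) * (n - 1)!) := by gcongr
    _ = (n : ℝ) * ((n : ℝ) * (n - 1)! * (n - 2 * i)!) := by ring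
    _ ≤ (1 + 2 / (n : ℝ)) * i ! * ((n : ℝ) - i) * ((n : ℝ) * (n - 1)! * (n - 2 * i)!) :=
        mul_le_mul_of_nonneg_right h4 (by positivity)
    _ = _ := by rw [h3]; ring

/-- Induction on `m`: for `l ≤ m`, `(1 + 1/m)^l ≤ e < 3`. -/
lemma pow_mul_factorial_sub_le (m : ℕ) : ∀ l ≤ m,
    (m : ℝ) ^ l * (m - l)! ≤ 3 ^ l * m ! := by
  induction m with
  | zero => intro l hl; obtain rfl : l = 0 := by omega
            simp
  | succ m ih =>
    intro l hl
    rcases l with _ | l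
    · simp
    have hl' : l ≤ m := by omega
    rw [Nat.add_sub_add_right, Nat.factorial_succ]
    have key : ((m + 1 : ℕ) : ℝ) ^ l ≤ 3 * (m : ℝ) ^ l := by
      rcases Nat.eq_zero_or_pos m with rfl | hm
      · obtain rfl : l = 0 := by omega
        norm_num
      have hm0 : (0 : ℝ) < m := by exact_mod_cast hm
      have h1 : ((m + 1 : ℕ) : ℝ) ≤ m * Real.exp (1 / m) := by
        have := Real.add_one_le_exp (1 / (m : ℝ))
        calc ((m + 1 : ℕ) : ℝ) = m * (1 / m + 1) := by push_cast; field_simp; ring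
          _ ≤ _ := by gcongr
      calc _ ≤ (m * Real.exp (1 / m)) ^ l := by gcongr
        _ = m ^ l * Real.exp (l * (1 / m)) := by rw [mul_pow, ← Real.exp_nat_mul]
        _ ≤ m ^ l * Real.exp 1 := by
            gcongr
            rw [mul_one_div, div_le_one hm0]; exact_mod_cast hl'
        _ ≤ m ^ l * 3 := by gcongr; exact Real.exp_one_lt_three.le
        _ = _ := by ring
    calc _ = ((m + 1 : ℕ) : ℝ) * (((m + 1 : ℕ) : ℝ) ^ l * (m - l)!) := by ring
      _ ≤ ((m + 1 : ℕ) : ℝ) * (3 * (m : ℝ) ^ l * (m - l)!) := by gcongr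
      _ = 3 * ((m + 1 : ℕ) : ℝ) * ((m : ℝ) ^ l * (m - l)!) := by ring
      _ ≤ 3 * ((m + 1 : ℕ) : ℝ) * (3 ^ l * m !) :=
          mul_le_mul_of_nonneg_left (ih l hl') (by positivity)
      _ = _ := by push_cast; ring

end Factorials

/-! ### Norms of Chebyshev polynomials -/

section CoefficientNorm

open Polynomial

/-- The squared norm `∑ pᵢ² i! / εⁱ` of a polynomial in `H(K)`, truncated at degree `n`. -/
noncomputable def coeffNormSq (ε : ℝ) (n : ℕ) (p : ℝ[X]) : ℝ :=
  ∑ i ∈ Finset.range (n + 1), p.coeff i ^ 2 * (i ! / ε ^ i)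

lemma coeffNormSq_eq_of_natDegree_le {ε : ℝ} {m n : ℕ} (hmn : m ≤ n) {p : ℝ[X]}
    (hp : p.natDegree ≤ m) : coeffNormSq ε n p = coeffNormSq ε m p := by
  symm
  refine Finset.sum_subset (by simpa using hmn) fun i _ hi => ?_
  rw [coeff_eq_zero_of_natDegree_lt (by simp at hi; omega)]
  simp

/-- The term of degree `n - 2i` is at most a common factor times `(ε²/16)^i / i!`; summing gives the
exponential. -/
lemma coeffNormSq_chebyshevT_le {ε : ℝ} (hε : 0 < ε) {n : ℕ} (hn : 1 ≤ n) :
    coeffNormSq ε n (Chebyshev.T ℝ (n : ℤ)) ≤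
      4 ^ n * n ! / ε ^ n / 4 * (1 + 2 / n) * Real.exp (ε ^ 2 / 16) := by
  have hsum : coeffNormSq ε n (Chebyshev.T ℝ (n : ℤ)) = ∑ i ∈ Finset.range (n / 2 + 1),
      (Chebyshev.T ℝ (n : ℤ)).coeff (n - 2 * i) ^ 2 * ((n - 2 * i)! / ε ^ (n - 2 * i)) := by
    symm
    refine Finset.sum_of_injOn (fun i => n - 2 * i) ?_ ?_ ?_ fun _ _ => rfl
    · intro a ha b hb hab
      simp only [Finset.coe_range, Set.mem_Iio] at ha hb
      simp only at hab
      omega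
    · intro a _
      simp only [Finset.coe_range, Set.mem_Iio]
      omega
    · intro k hk hk'
      rw [coeff_chebyshevT_of_odd]
      · simp
      · by_contra hodd
        rw [Nat.not_odd_iff_even] at hodd
        refine hk' ⟨(n - k) / 2, ?_, ?_⟩
        · simp only [Finset.coe_range, Set.mem_Iio]
          omega
        · simp only [Finset.mem_range] at hk
          obtain ⟨r, hr⟩ := hodd
          simp only
          omega
  rw [hsum]
  calc _ ≤ ∑ i ∈ Finset.range (n / 2 + 1),
        4 ^ n * n ! / ε ^ n / 4 * (1 + 2 / n) * ((ε ^ 2 / 16) ^ i / i !) := by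
        refine Finset.sum_le_sum fun i hi => ?_
        have hi2 : 2 * i ≤ n := by simp only [Finset.mem_range] at hi; omega
        have hfac := mul_factorial_sq_le hn hi2
        rw [coeff_chebyshevT n hn i (n - 2 * i) (by omega),
          show i + (n - 2 * i) - 1 = n - i - 1 by omega]
        set k := n - 2 * i with hk
        have hnk : n = k + 2 * i := by omega
        have h4 : (4 : ℝ) ^ n / ε ^ n * (ε ^ 2 / 16) ^ i = 4 ^ k / ε ^ k := by
          rw [hnk, pow_add, pow_add, pow_mul, pow_mul, div_pow]
          have : (4 : ℝ) ^ 2 = 16 := by norm_num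
          rw [this]
          field_simp
        have hs : ((-1 : ℝ) ^ i) ^ 2 = 1 := by rw [← pow_mul, mul_comm, pow_mul]; simp
        have h2 : ((2 : ℝ) ^ k) ^ 2 = 4 ^ k := by rw [pow_right_comm]; norm_num
        calc _ = (4 : ℝ) ^ k / ε ^ k / (4 * (k ! * (i ! : ℝ) ^ 2)) *
              ((n : ℝ) ^ 2 * ((n - i - 1)! : ℝ) ^ 2) := by
              rw [div_pow, mul_pow, mul_pow, mul_pow, hs, h2]
              field_simp
              ring
          _ ≤ (4 : ℝ) ^ k / ε ^ k / (4 * (k ! * (i ! : ℝ) ^ 2)) *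
              ((1 + 2 / n) * (n ! * k ! * i !)) := by gcongr
          _ = (4 : ℝ) ^ k / ε ^ k * (n ! / 4 * (1 + 2 / n) / i !) := by
              field_simp
          _ = _ := by rw [← h4]; ring
    _ ≤ _ := by
        rw [← Finset.mul_sum]
        gcongr
        exact Real.sum_le_exp_of_nonneg (by positivity) _

end CoefficientNorm

/-! ### Lower bound from polynomials vanishing at the nodes -/

section LowerBound

open Polynomial

/-- The mean of `T_j²` with respect to the arcsine distribution. -/
noncomputable def chebyshevWeight (j : ℕ) : ℝ := if j = 0 then 1 else 1 / 2

lemma chebyshevWeight_pos (j : ℕ) : 0 < chebyshevWeight j := by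
  rw [chebyshevWeight]; split_ifs <;> norm_num

/-- Equality holds at `j = n - 1`. The gain `1/n` lets all `n` lower degrees together contribute
only a multiple of `ε` times the top term. -/
lemma pow_mul_factorial_div_le {ε : ℝ} (hε : 0 < ε) {n j : ℕ} (hn : 5 * ε ≤ n) (hn2 : 2 ≤ n)
    (hj : j < n) : 4 ^ j * j ! / ε ^ j ≤ 4 ^ n * n ! / ε ^ n * (ε / (4 * n)) := by
  obtain ⟨m, rfl⟩ : ∃ m, n = m + 1 := ⟨n - 1, by omega⟩
  obtain ⟨l, hl⟩ : ∃ l, m = j + l := ⟨m - j, by omega⟩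
  have hm1 : 1 ≤ m := by omega
  have hm1' : (1 : ℝ) ≤ m := by exact_mod_cast hm1
  have h := pow_mul_factorial_sub_le m l (by omega)
  rw [show m - l = j by omega] at h
  have h3 : (3 * (ε / 4)) ^ l ≤ (m : ℝ) ^ l := by
    push_cast at hn
    gcongr
    linarith
  have h4 : (ε / 4) ^ l * j ! ≤ m ! := by
    refine le_of_mul_le_mul_left ?_ (by positivity : (0 : ℝ) < 3 ^ l)
    calc _ = (3 * (ε / 4)) ^ l * j ! := by rw [mul_pow]; ring
      _ ≤ (m : ℝ) ^ l * j ! := by gcongr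
      _ ≤ _ := h
  calc _ = (4 : ℝ) ^ (j + l) / ε ^ (j + l) * ((ε / 4) ^ l * j !) := by
        rw [pow_add, pow_add, div_pow]; field_simp
    _ ≤ (4 : ℝ) ^ (j + l) / ε ^ (j + l) * m ! := by gcongr
    _ = _ := by
        rw [← hl, Nat.factorial_succ, pow_succ, pow_succ]
        push_cast
        field_simp

lemma sum_coeffNormSq_chebyshevT_le {ε : ℝ} (hε : 0 < ε) {n : ℕ} (hn : 5 * ε ≤ n)
    (hn9 : 9 ≤ ε * n) (hn2 : 2 ≤ n) :
    ∑ j ∈ Finset.range (n + 1), coeffNormSq ε n (Chebyshev.T ℝ (j : ℤ)) / chebyshevWeight j ≤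
      4 ^ n * n ! / ε ^ n * ((1 + ε) / 2 * Real.exp (ε ^ 2 / 16)) := by
  have hn0 : (0 : ℝ) < n := by positivity
  set q := Real.exp (ε ^ 2 / 16) with hq
  have hq1 : 1 ≤ q := Real.one_le_exp (by positivity)
  set B : ℝ := 4 ^ n * n ! / ε ^ n with hB
  have hB0 : 0 < B := by positivity
  have hred : ∀ j ≤ n, coeffNormSq ε n (Chebyshev.T ℝ (j : ℤ)) =
      coeffNormSq ε j (Chebyshev.T ℝ (j : ℤ)) := fun j hj =>
    coeffNormSq_eq_of_natDegree_le hj (by simp [Chebyshev.natDegree_T])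
  have hlow : ∀ j ∈ Finset.range n,
      coeffNormSq ε n (Chebyshev.T ℝ (j : ℤ)) / chebyshevWeight j ≤
        B * (3 / 2 * q * (ε / (4 * n))) := by
    intro j hj
    have hjn : j < n := by simpa using hj
    have hv := pow_mul_factorial_div_le hε hn hn2 hjn
    rw [hred j hjn.le]
    have : coeffNormSq ε j (Chebyshev.T ℝ (j : ℤ)) / chebyshevWeight j ≤
        3 / 2 * q * (4 ^ j * j ! / ε ^ j) := by
      rcases Nat.eq_zero_or_pos j with rfl | hj0
      · simp [coeffNormSq, chebyshevWeight]; linarith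
      · have hj1 : (1 : ℝ) ≤ j := by exact_mod_cast hj0
        have h2j : 2 / (j : ℝ) ≤ 2 := by rw [div_le_iff₀ (by linarith)]; linarith
        rw [chebyshevWeight, if_neg hj0.ne']
        calc _ ≤ (4 ^ j * j ! / ε ^ j / 4 * (1 + 2 / j) * q) / (1 / 2) := by
              gcongr; exact coeffNormSq_chebyshevT_le hε hj0
          _ ≤ (4 ^ j * j ! / ε ^ j / 4 * (1 + 2) * q) / (1 / 2) := by gcongr
          _ = _ := by ring
    calc _ ≤ 3 / 2 * q * (4 ^ j * j ! / ε ^ j) := this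
      _ ≤ 3 / 2 * q * (B * (ε / (4 * n))) := by gcongr
      _ = _ := by ring
  have htop : coeffNormSq ε n (Chebyshev.T ℝ (n : ℤ)) / chebyshevWeight n ≤
      B * ((1 / 2 + 1 / n) * q) := by
    rw [chebyshevWeight, if_neg (by omega)]
    calc _ ≤ (B / 4 * (1 + 2 / n) * q) / (1 / 2) := by
          gcongr; exact coeffNormSq_chebyshevT_le hε (by omega)
      _ = _ := by ring
  -- Then `3/8 + 1/9 < 1/2`, which produces the factor `(1 + ε)/2` behind `c₁`.
  have h1n : 1 / (n : ℝ) ≤ ε / 9 := by rw [div_le_div_iff₀ hn0 (by norm_num)]; linarith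
  rw [Finset.sum_range_succ]
  calc _ ≤ ∑ j ∈ Finset.range n, B * (3 / 2 * q * (ε / (4 * n))) + B * ((1 / 2 + 1 / n) * q) :=
        add_le_add (Finset.sum_le_sum hlow) htop
    _ = B * (q * (3 / 8 * ε + 1 / 2 + 1 / n)) := by
        rw [Finset.sum_const, Finset.card_range, nsmul_eq_mul]; field_simp; ring
    _ ≤ B * (q * ((1 + ε) / 2)) := by gcongr; linarith
    _ = _ := by ring

/-- The polynomial with Chebyshev coefficients `a`. -/
noncomputable def chebyshevSum (n : ℕ) (a : ℕ → ℝ) : ℝ[X] :=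
  ∑ j ∈ Finset.range (n + 1), C (a j) * Chebyshev.T ℝ (j : ℤ)

lemma natDegree_chebyshevSum_le (n : ℕ) (a : ℕ → ℝ) : (chebyshevSum n a).natDegree ≤ n := by
  refine natDegree_sum_le_of_forall_le _ _ fun j hj => (natDegree_C_mul_le _ _).trans ?_
  simp only [Finset.mem_range] at hj
  simp only [Chebyshev.natDegree_T, Int.natAbs_natCast]
  omega

/-- Cauchy–Schwarz over `j`, separately in each monomial coefficient. -/
lemma coeffNormSq_chebyshevSum_le {ε : ℝ} (hε : 0 < ε) (n : ℕ) (a : ℕ → ℝ) :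
    coeffNormSq ε n (chebyshevSum n a) ≤
      (∑ j ∈ Finset.range (n + 1), chebyshevWeight j * a j ^ 2) *
        ∑ j ∈ Finset.range (n + 1),
          coeffNormSq ε n (Chebyshev.T ℝ (j : ℤ)) / chebyshevWeight j := by
  simp only [coeffNormSq, Finset.sum_div]
  rw [Finset.sum_comm, Finset.mul_sum]
  refine Finset.sum_le_sum fun i _ => ?_
  have hcs := Finset.sum_sq_le_sum_mul_sum_of_sq_le_mul (Finset.range (n + 1))
    (r := fun j => a j * (Chebyshev.T ℝ (j : ℤ)).coeff i)
    (f := fun j => chebyshevWeight j * a j ^ 2)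
    (g := fun j => (Chebyshev.T ℝ (j : ℤ)).coeff i ^ 2 / chebyshevWeight j)
    (fun j _ => mul_nonneg (chebyshevWeight_pos j).le (sq_nonneg _))
    (fun j _ => div_nonneg (sq_nonneg _) (chebyshevWeight_pos j).le)
    (fun j _ => by have := (chebyshevWeight_pos j).ne'; exact le_of_eq (by field_simp))
  have hc : (chebyshevSum n a).coeff i =
      ∑ j ∈ Finset.range (n + 1), a j * (Chebyshev.T ℝ (j : ℤ)).coeff i := by
    simp [chebyshevSum]
  rw [hc]
  calc _ ≤ _ := mul_le_mul_of_nonneg_right hcs (by positivity)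
    _ = _ := by
        rw [mul_assoc]
        congr 1
        rw [Finset.sum_mul]
        exact Finset.sum_congr rfl fun j _ => by ring

lemma integral_chebyshevSum_sq (n : ℕ) (a : ℕ → ℝ) :
    ∫ θ in (0 : ℝ)..Real.pi, (chebyshevSum n a).eval (Real.cos θ) ^ 2 =
      ∑ j ∈ Finset.range (n + 1), Real.pi * (chebyshevWeight j * a j ^ 2) := by
  have horth : ∀ i j : ℕ, ∫ θ in (0 : ℝ)..Real.pi,
      (Chebyshev.T ℝ (i : ℤ)).eval (Real.cos θ) * (Chebyshev.T ℝ (j : ℤ)).eval (Real.cos θ) =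
      if i = j then Real.pi * chebyshevWeight j else 0 := by
    intro i j
    rw [← Chebyshev.integral_measureT_eq_integral_cos
      (f := fun x => (Chebyshev.T ℝ (i : ℤ)).eval x * (Chebyshev.T ℝ (j : ℤ)).eval x)]
    split_ifs with hij
    · subst hij
      rcases eq_or_ne i 0 with rfl | hi
      · have := Chebyshev.integral_eval_T_real_mul_self_measureT_zero
        simpa [chebyshevWeight] using this
      · rw [Chebyshev.integral_T_real_mul_self_measureT_of_ne_zero hi, chebyshevWeight, if_neg hi]
        ring
    · exact Chebyshev.integral_eval_T_real_mul_eval_T_real_measureT_of_ne hij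
  have hexp : ∀ θ : ℝ, (chebyshevSum n a).eval (Real.cos θ) ^ 2 =
      ∑ i ∈ Finset.range (n + 1), ∑ j ∈ Finset.range (n + 1), a i * a j *
        ((Chebyshev.T ℝ (i : ℤ)).eval (Real.cos θ) *
          (Chebyshev.T ℝ (j : ℤ)).eval (Real.cos θ)) := by
    intro θ
    rw [chebyshevSum, eval_finsetSum, sq, Finset.sum_mul_sum]
    refine Finset.sum_congr rfl fun i _ => Finset.sum_congr rfl fun j _ => ?_
    simp only [eval_mul, eval_C]
    ring
  have hcont : ∀ i j : ℕ, Continuous fun θ : ℝ => a i * a j *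
        ((Chebyshev.T ℝ (i : ℤ)).eval (Real.cos θ) *
          (Chebyshev.T ℝ (j : ℤ)).eval (Real.cos θ)) := by
    intro i j; fun_prop
  simp only [hexp]
  rw [intervalIntegral.integral_finsetSum fun i _ =>
    (continuous_finsetSum _ fun j _ => hcont i j).intervalIntegrable _ _]
  refine Finset.sum_congr rfl fun i hi => ?_
  rw [intervalIntegral.integral_finsetSum fun j _ => (hcont i j).intervalIntegrable _ _]
  simp only [intervalIntegral.integral_const_mul, horth]
  rw [Finset.sum_eq_single_of_mem i hi fun j _ hji => by rw [if_neg hji.symm, mul_zero], if_pos rfl]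
  ring

/-- The left side is the mean of the squared polynomial under the arcsine law, so it cannot exceed
every value. -/
lemma exists_le_eval_chebyshevSum_sq (n : ℕ) (a : ℕ → ℝ) :
    ∃ x : Dom, ∑ j ∈ Finset.range (n + 1), chebyshevWeight j * a j ^ 2 ≤
      (chebyshevSum n a).eval (x : ℝ) ^ 2 := by
  by_contra! hcon
  set S := ∑ j ∈ Finset.range (n + 1), chebyshevWeight j * a j ^ 2 with hS
  have hlt : ∀ θ : ℝ, (chebyshevSum n a).eval (Real.cos θ) ^ 2 < S := fun θ =>
    hcon ⟨Real.cos θ, Real.neg_one_le_cos θ, Real.cos_le_one θ⟩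
  have := intervalIntegral.integral_lt_integral_of_continuousOn_of_le_of_exists_lt
    (f := fun θ => (chebyshevSum n a).eval (Real.cos θ) ^ 2) (g := fun _ => S) Real.pi_pos
    (by fun_prop) (by fun_prop) (fun θ _ => (hlt θ).le) ⟨0, by simp [Real.pi_pos.le], hlt 0⟩
  rw [integral_chebyshevSum_sq, ← Finset.mul_sum] at this
  simp [← hS] at this

/-- A nontrivial polynomial of degree at most `n` vanishing at `n` given points, in terms of its
Chebyshev coefficients. -/
lemma exists_chebyshevSum_vanishing {n : ℕ} (x : Fin n → Dom) :
    ∃ a : ℕ → ℝ, 0 < ∑ j ∈ Finset.range (n + 1), chebyshevWeight j * a j ^ 2 ∧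
      ∀ k, (chebyshevSum n a).eval (x k : ℝ) = 0 := by
  set L : (Fin (n + 1) → ℝ) →ₗ[ℝ] (Fin n → ℝ) := Matrix.toLin'
    (Matrix.of fun k j => (Chebyshev.T ℝ ((j : ℕ) : ℤ)).eval (x k : ℝ)) with hL
  -- There are `n + 1` coefficients and only `n` conditions.
  have hker : LinearMap.ker L ≠ ⊥ := LinearMap.ker_ne_bot_of_finrank_lt (by simp)
  obtain ⟨b, hb, hb0⟩ := (Submodule.ne_bot_iff _).1 hker
  set a : ℕ → ℝ := fun j => if h : j < n + 1 then b ⟨j, h⟩ else 0 with ha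
  have hab : ∀ j : Fin (n + 1), a j = b j := fun j => by rw [ha]; exact dif_pos j.2
  refine ⟨a, ?_, fun k => ?_⟩
  · obtain ⟨j, hj⟩ := Function.ne_iff.1 hb0
    refine Finset.sum_pos' (fun i _ => mul_nonneg (chebyshevWeight_pos i).le (sq_nonneg _))
      ⟨j, Finset.mem_range.2 j.2, mul_pos (chebyshevWeight_pos _) ?_⟩
    rw [hab]
    have hj' : b j ≠ 0 := hj
    positivity
  · have h := congrFun (LinearMap.mem_ker.1 hb) k
    simp only [hL, Matrix.toLin'_apply, Matrix.mulVec, dotProduct, Matrix.of_apply,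
      Pi.zero_apply] at h
    rw [chebyshevSum, eval_finsetSum, Finset.sum_range, ← h]
    refine Finset.sum_congr rfl fun j _ => ?_
    rw [hab, eval_mul, eval_C, mul_comm]

/-- As `p` vanishes at the nodes, `p(x)` is the error functional applied to `p`, that is `∑ pᵢ dᵢ`
with `dᵢ` the moments about 0; Cauchy–Schwarz then applies to the coefficients. -/
lemma eval_sq_le_coeffNormSq_mul {ε : ℝ} (hε : 0 < ε) [Fact (kernelMatrix (expKernel ε)).PosSemidef]
    {n m : ℕ} (A : LinApprox n) {p : ℝ[X]} (hp : p.natDegree ≤ m)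
    (h0 : ∀ k, p.eval (A.point k : ℝ) = 0) (x : Dom) :
    p.eval (x : ℝ) ^ 2 ≤ coeffNormSq ε m p * ‖A.errorRep (expKernel ε) x‖ ^ 2 := by
  set z : Option (Fin n) → Dom := fun i => i.elim x A.point with hz
  set w : Option (Fin n) → ℝ := fun i => i.elim 1 fun k => - A.weight k x with hw
  set d : ℕ → ℝ := fun i => ∑ j, w j * (z j : ℝ) ^ i with hd
  have hsum := hasSum_norm_kerComb_expKernel (ε := ε) z w 0
  have hle : ∑ i ∈ Finset.range (m + 1), ε ^ i / i ! * d i ^ 2 ≤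
      ‖A.errorRep (expKernel ε) x‖ ^ 2 := by
    refine le_trans (le_of_eq ?_) (sum_le_hasSum (Finset.range (m + 1))
      (fun _ _ => by positivity) hsum)
    simp [hd]
  have heval : p.eval (x : ℝ) = ∑ i ∈ Finset.range (m + 1), p.coeff i * d i := by
    have h1 : p.eval (x : ℝ) = ∑ j, w j * p.eval (z j : ℝ) := by
      simp [Fintype.sum_option, hw, hz, h0]
    rw [h1]
    simp only [eval_eq_sum_range' (Nat.lt_succ_of_le hp), hd, Finset.mul_sum]
    rw [Finset.sum_comm]
    exact Finset.sum_congr rfl fun i _ => Finset.sum_congr rfl fun j _ => by ring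
  rw [heval]
  refine (Finset.sum_sq_le_sum_mul_sum_of_sq_le_mul (Finset.range (m + 1))
    (f := fun i => p.coeff i ^ 2 * (i ! / ε ^ i)) (g := fun i => ε ^ i / i ! * d i ^ 2)
    (fun i _ => by positivity) (fun i _ => by positivity) fun i _ => ?_).trans ?_
  · exact le_of_eq (by field_simp)
  · rw [coeffNormSq]
    gcongr

lemma le_worstCaseError {ε : ℝ} (hε : 0 < ε) {n : ℕ} (hn : mL ε ≤ n) (A : LinApprox n) :
    ENNReal.ofReal (c₁ ε * (√ε / 2) ^ n * (n ! : ℝ) ^ (-(1 / 2) : ℝ)) ≤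
      worstCaseError (expKernel ε) (expKernel_posSemidef hε.le) A := by
  have : Fact (kernelMatrix (expKernel ε)).PosSemidef := ⟨expKernel_posSemidef hε.le⟩
  have h5 := five_mul_le_of_mL_le hn
  have h9 := nine_le_mul_of_mL_le hε hn
  -- If `n ≤ 1`, then `5ε ≤ n` and `9 ≤ εn` contradict each other.
  have hn2 : 2 ≤ n := by
    by_contra! h
    have : (n : ℝ) ≤ 1 := by exact_mod_cast (by omega : n ≤ 1)
    nlinarith
  obtain ⟨a, ha, hzero⟩ := exists_chebyshevSum_vanishing A.point
  obtain ⟨x, hx⟩ := exists_le_eval_chebyshevSum_sq n a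
  set S := ∑ j ∈ Finset.range (n + 1), chebyshevWeight j * a j ^ 2 with hS
  set R := ‖A.errorRep (expKernel ε) x‖ with hR
  have h1 := eval_sq_le_coeffNormSq_mul hε A (natDegree_chebyshevSum_le n a) hzero x
  have h2 : S * 1 ≤ S * (4 ^ n * n ! / ε ^ n * ((1 + ε) / 2 * Real.exp (ε ^ 2 / 16)) * R ^ 2) := by
    rw [mul_one, ← mul_assoc]
    refine (hx.trans h1).trans (mul_le_mul_of_nonneg_right ?_ (sq_nonneg _))
    refine (coeffNormSq_chebyshevSum_le hε n a).trans (mul_le_mul_of_nonneg_left ?_ ha.le)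
    exact sum_coeffNormSq_chebyshevT_le hε h5 h9 hn2
  have h3 := le_of_mul_le_mul_left h2 ha
  refine le_trans (ENNReal.ofReal_le_ofReal (le_of_sq_le_sq ?_ (norm_nonneg _)))
    (norm_errorRep_le_errorOn A x)
  rw [mul_pow, mul_pow, rpow_neg_half_sq (by positivity), pow_right_comm, div_pow,
    Real.sq_sqrt hε.le, c₁, mul_pow, Real.sq_sqrt (by positivity)]
  have he : Real.exp (-(1 / 32) * ε ^ 2) ^ 2 = (Real.exp (ε ^ 2 / 16))⁻¹ := by
    rw [← Real.exp_nat_mul, ← Real.exp_neg]; congr 1; push_cast; ring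
  rw [he]
  have hb : (2 / (1 + ε) * (Real.exp (ε ^ 2 / 16))⁻¹ * (ε / 2 ^ 2) ^ n * (n ! : ℝ)⁻¹) *
      (4 ^ n * n ! / ε ^ n * ((1 + ε) / 2 * Real.exp (ε ^ 2 / 16))) = 1 := by
    rw [div_pow]; norm_num; field_simp
  have hpos : 0 < 2 / (1 + ε) * (Real.exp (ε ^ 2 / 16))⁻¹ * (ε / 2 ^ 2) ^ n * (n ! : ℝ)⁻¹ := by
    positivity
  calc _ ≤ (2 / (1 + ε) * (Real.exp (ε ^ 2 / 16))⁻¹ * (ε / 2 ^ 2) ^ n * (n ! : ℝ)⁻¹) *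
        (4 ^ n * n ! / ε ^ n * ((1 + ε) / 2 * Real.exp (ε ^ 2 / 16)) * R ^ 2) :=
        le_mul_of_one_le_right hpos.le h3
    _ = R ^ 2 := by rw [← mul_assoc, hb, one_mul]

end LowerBound

/-! ### Chebyshev nodes and the final estimates -/

section Main

open Polynomial

/-- For the roots of `Tₙ` the nodal polynomial is `Tₙ / 2^(n-1)`, and `|Tₙ| ≤ 1` on `[-1, 1]`. -/
lemma exists_chebyshev_nodes {n : ℕ} (hn : 1 ≤ n) : ∃ x : Fin n → Dom, Function.Injective x ∧
    ∀ y : Dom, |∏ k, ((y : ℝ) - x k)| ≤ 2 / 2 ^ n := by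
  set v : ℕ → ℝ := fun k => Real.cos ((2 * k + 1) * Real.pi / (2 * n)) with hv
  have hnd := Chebyshev.roots_T_real_nodup n
  have hinj := (Finset.range n).nodup_map_iff_injOn.mp hnd
  refine ⟨fun k => ⟨v k, Real.neg_one_le_cos _, Real.cos_le_one _⟩, ?_, fun y => ?_⟩
  · intro i j hij
    exact Fin.ext (hinj (by simp) (by simp) (Subtype.mk.inj hij))
  · have hroots := Chebyshev.roots_T_real n
    have hval : ((Finset.range n).image v).val = (Finset.range n).val.map v :=
      Finset.image_val_of_injOn hinj
    have hcard : (Chebyshev.T ℝ (n : ℤ)).roots.card = (Chebyshev.T ℝ (n : ℤ)).natDegree := by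
      rw [hroots, hval]; simp [Chebyshev.natDegree_T]
    have hprod := C_leadingCoeff_mul_prod_multiset_X_sub_C hcard
    have hev := congrArg (eval (y : ℝ)) hprod
    rw [hroots, hval, Chebyshev.leadingCoeff_T, Multiset.map_map] at hev
    change eval _ (C _ * ∏ k ∈ Finset.range n, (X - C (v k))) = _ at hev
    rw [eval_mul, eval_C, eval_prod, Finset.prod_range] at hev
    simp only [eval_sub, eval_X, eval_C, Int.natAbs_natCast] at hev
    have hT := Chebyshev.abs_eval_T_real_le_one n (abs_le.2 y.2)
    rw [← hev, abs_mul, abs_of_pos (by positivity)] at hT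
    obtain ⟨m, rfl⟩ : ∃ m, n = m + 1 := ⟨n - 1, by omega⟩
    rw [Nat.add_sub_cancel] at hT
    rw [pow_succ, le_div_iff₀ (by positivity)]
    linarith

end Main

end ExpKernel

theorem mainTheorem7 (ε : ℝ) (hε : 0 < ε) (n : ℕ) (hn : ExpKernel.mL ε ≤ (n : ℝ)) :
    (ENNReal.ofReal (ExpKernel.c₁ ε * (√ε / 2) ^ n * (n ! : ℝ) ^ (-(1 / 2) : ℝ))
        ≤ ExpKernel.minimalError (ExpKernel.expKernel ε)
            (ExpKernel.expKernel_posSemidef hε.le) n ∧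
      ExpKernel.minimalError (ExpKernel.expKernel ε)
            (ExpKernel.expKernel_posSemidef hε.le) n
        ≤ ENNReal.ofReal (ExpKernel.c₂ ε * (n : ℝ) ^ (-(1 / 8) : ℝ) * Real.exp √(ε * n)
            * (√ε / 2) ^ n * (n ! : ℝ) ^ (-(1 / 2) : ℝ))) ∧
    ∀ x : Fin n → ExpKernel.Dom, Function.Injective x →
      ∃ A : ExpKernel.LinApprox n, A.point = x ∧
        ENNReal.ofReal (ExpKernel.c₁ ε * (√ε / 2) ^ n * (n ! : ℝ) ^ (-(1 / 2) : ℝ))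
          ≤ ExpKernel.worstCaseError (ExpKernel.expKernel ε)
              (ExpKernel.expKernel_posSemidef hε.le) A ∧
        ExpKernel.worstCaseError (ExpKernel.expKernel ε)
              (ExpKernel.expKernel_posSemidef hε.le) A
          ≤ ENNReal.ofReal (ExpKernel.c₂ ε / 2 * (n : ℝ) ^ (-(1 / 8) : ℝ) * Real.exp √(ε * n)
              * (2 * √ε) ^ n * (n ! : ℝ) ^ (-(1 / 2) : ℝ)) := by
  have hn1 : 1 ≤ n := by
    have h9 := ExpKernel.nine_le_mul_of_mL_le hε hn
    by_contra! h
    obtain rfl : n = 0 := by omega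
    norm_num at h9
  refine ⟨⟨le_iInf fun A => ExpKernel.le_worstCaseError hε hn A, ?_⟩, fun x hx =>
    ⟨ExpKernel.weightedInterp ε x hx, rfl, ExpKernel.le_worstCaseError hε hn _, ?_⟩⟩
  · obtain ⟨x, hx, hW⟩ := ExpKernel.exists_chebyshev_nodes hn1
    refine (iInf_le _ (ExpKernel.weightedInterp ε x hx)).trans
      ((ExpKernel.worstCaseError_weightedInterp_le hε hn hx hW).trans (le_of_eq ?_))
    rw [ExpKernel.c₂, div_pow]
    congr 1
    ring
  · have hW : ∀ y : ExpKernel.Dom, |∏ k, ((y : ℝ) - x k)| ≤ 2 ^ n := by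
      intro y
      rw [Finset.abs_prod]
      refine (Finset.prod_le_prod (fun _ _ => abs_nonneg _) fun k _ => ?_).trans_eq
        (by simp : ∏ _k : Fin n, (2 : ℝ) = 2 ^ n)
      have h1 := abs_le.2 y.2
      have h2 := abs_le.2 (x k).2
      exact (abs_sub _ _).trans (by linarith)
    refine (ExpKernel.worstCaseError_weightedInterp_le hε hn hx hW).trans (le_of_eq ?_)
    rw [ExpKernel.c₂, mul_pow]
    congr 1
    ring
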